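/- Let $\mathcal X_1,\mathcal X_2,\mathcal Y$ be finite alphabets, let $P(y|x_1,x_2)$ be a channel, let $d_{\min},d_{\max}\ge 0$ be integers, and put $\mathcal D=\{-d_{\min},\dots,d_{\max}\}$ and $D=d_{\min}+d_{\max}+1$. In the asynchronous cognitive multiple access channel (ACMAC) with delay $d\in\mathcal D$, inputs $\mathbf x_1\in\mathcal X_1^n$, $\mathbf x_2\in\mathcal X_2^n$ produce the output $\mathbf y\in\mathcal Y^n$ with probability $P_d(\mathbf y|\mathbf x_1,\mathbf x_2)=\prod_{i=1}^n P(y_i|x_{1,i-d},x_{2,i})$, where the symbols $x_{1,i-d}$ with $i-d\notin\{1,\dots,n\}$ are arbitrary. A $(2^{nR_1},2^{nR_2},n)$-code consists of encoders $f_1:\mathcal M_1\to\mathcal X_1^n$, $f_2:\mathcal M_1\times\mathcal M_2\to\mathcal X_2^n$ and a decoder $g:\mathcal Y^n\to\mathcal M_1\times\mathcal M_2$, none of which depends on the delay, with $|\mathcal M_k|=\lceil 2^{nR_k}\rceil$. A pair $(R_1,R_2)$ of nonnegative rates is achievable if there are such codes, for all $n$, and $\epsilon_n\to0$ such that for every $d\in\mathcal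 D$, whatever the arbitrary symbols are (they may vary with the pair of messages), the error probability averaged over uniformly distributed message pairs is at most $\epsilon_n$. The capacity region is the closure of the set of achievable rate pairs. For probability mass functions $P(x_1)$ on $\mathcal X_1$ and $P(x_2|\overline v)$, $\overline v=(v_1,\dots,v_D)\in\mathcal X_1^D$, and for $d\in\mathcal D$, let $(X_1,\overline V,X_2,Y)$ have the law $$P_d(x_1,\overline v,x_2,y)=\Big(\prod_{j=1}^{D}P(v_j)\Big)\mathbf 1\{x_1=v_{d_{\max}-d+1}\}\,P(x_2|\overline v)\,P(y|x_1,x_2),$$ where $P(v_j)$ is the value at $v_j$ of the mass function $P(x_1)$, and let $I_d$ denote (conditional) mutual information in bits under this law. Let $$\underline{\mathcal R}=\bigcup_{P(x_1),\,P(x_2|\overline v)}\Big\{(R_1,R_2): R_1,R_2\ge0,\ R_1+R_2\le\min_{d\in\mathcal D}\big[I_d(X_1;Y)+I_d(X_2;Y|\overline V)\big],\ R_2\le\min_{d\in\mathcal D}I_d(X_2;Y|\overline V)\Big\}.$$ Then the closed convex hull of $\underline{\mathcal R}$ is an achievable rate region for the ACMAC, that is, it is contained in the capacity region. -/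

import Mathlib

open Filter Topology

noncomputable section

namespace ACMAC

/-- Mutual information `I(A;B)` in bits of a joint probability mass function `p(a,b)`
on finite alphabets, with the convention `0 log 0 = 0`. -/
def mutualInfo {A B : Type*} [Fintype A] [Fintype B] (p : A → B → ℝ) : ℝ :=
  ∑ a, ∑ b, p a b * Real.logb 2 (p a b / ((∑ b', p a b') * (∑ a', p a' b)))

/-- Conditional mutual information `I(A;B|C)` in bits of a joint probability mass function
`p(c,a,b)` on finite alphabets: the sum of
`p(c,a,b) log (p(c) p(c,a,b) / (p(c,a) p(c,b)))`. -/
def condMutualInfo {C A B : Type*} [Fintype C] [Fintype A] [Fintype B]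
    (p : C → A → B → ℝ) : ℝ :=
  ∑ c, ∑ a, ∑ b, p c a b * Real.logb 2
    ((∑ a', ∑ b', p c a' b') * p c a b / ((∑ b', p c a b') * (∑ a', p c a' b)))

/-- The set of delays `{-dMin, ..., dMax}`, as a type. -/
abbrev Delay (dMin dMax : ℕ) : Type := ↥(Finset.Icc (-(dMin : ℤ)) (dMax : ℤ))

theorem delay_nonempty (dMin dMax : ℕ) : Nonempty (Delay dMin dMax) :=
  ⟨⟨0, by simp⟩⟩

/-- The windows `(v_1, ..., v_D)` with `D = dMin + dMax + 1`; the entry `v_j` has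
index `j - 1` here. -/
abbrev Window (X₁ : Type*) (dMin dMax : ℕ) : Type _ := Fin (dMin + dMax + 1) → X₁

/-- The (zero-based) position `dMax - d` of the entry `v_{dMax - d + 1}` of the window. -/
def windowIndex {dMin dMax : ℕ} (d : Delay dMin dMax) : Fin (dMin + dMax + 1) :=
  ⟨((dMax : ℤ) - d.1).toNat, by have := Finset.mem_Icc.mp d.2; omega⟩

section Channel

variable {X₁ X₂ Y : Type*} [Fintype X₁] [Fintype X₂] [Fintype Y]

open Classical in
/-- The joint law
`P_d(x₁, v, x₂, y) = (∏_j P(v_j)) 1{x₁ = v_{dMax-d+1}} P(x₂ | v) P(y | x₁, x₂)`. -/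
def jointLaw (W : X₁ → X₂ → stdSimplex ℝ Y) {dMin dMax : ℕ}
    (p : stdSimplex ℝ X₁) (q : Window X₁ dMin dMax → stdSimplex ℝ X₂)
    (d : Delay dMin dMax) (x₁ : X₁) (v : Window X₁ dMin dMax) (x₂ : X₂) (y : Y) : ℝ :=
  (∏ j, p (v j)) * (if x₁ = v (windowIndex d) then 1 else 0) * q v x₂ * W x₁ x₂ y

/-- `I_d(X₁; Y)`. -/
def infoX₁Y (W : X₁ → X₂ → stdSimplex ℝ Y) {dMin dMax : ℕ}
    (p : stdSimplex ℝ X₁) (q : Window X₁ dMin dMax → stdSimplex ℝ X₂)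
    (d : Delay dMin dMax) : ℝ :=
  mutualInfo fun x₁ y => ∑ v, ∑ x₂, jointLaw W p q d x₁ v x₂ y

/-- `I_d(X₂; Y | V)`. -/
def infoX₂YgivenV (W : X₁ → X₂ → stdSimplex ℝ Y) {dMin dMax : ℕ}
    (p : stdSimplex ℝ X₁) (q : Window X₁ dMin dMax → stdSimplex ℝ X₂)
    (d : Delay dMin dMax) : ℝ :=
  condMutualInfo fun v x₂ y => ∑ x₁, jointLaw W p q d x₁ v x₂ y

/-- The union over all `P(x₁)` and `P(x₂ | v)` of the sets of pairs of nonnegative rates with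
`R₁ + R₂ ≤ min_d [I_d(X₁;Y) + I_d(X₂;Y|V)]` and `R₂ ≤ min_d I_d(X₂;Y|V)`.
The set of delays is finite and nonempty, so the infima are minima. -/
def innerRegion (W : X₁ → X₂ → stdSimplex ℝ Y) (dMin dMax : ℕ) : Set (ℝ × ℝ) :=
  ⋃ (p : stdSimplex ℝ X₁) (q : Window X₁ dMin dMax → stdSimplex ℝ X₂),
    {R : ℝ × ℝ | 0 ≤ R.1 ∧ 0 ≤ R.2 ∧
      R.1 + R.2 ≤ (⨅ d : Delay dMin dMax, (infoX₁Y W p q d + infoX₂YgivenV W p q d)) ∧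
      R.2 ≤ ⨅ d : Delay dMin dMax, infoX₂YgivenV W p q d}

end Channel

/-- A deterministic code of block length `n` with `M₁` and `M₂` messages. Encoder 1 knows the
first message, encoder 2 knows both, and the decoder knows neither messages nor delay. -/
structure Code (X₁ X₂ Y : Type*) (M₁ M₂ n : ℕ) where
  /-- encoder 1 -/
  enc₁ : Fin M₁ → Fin n → X₁
  /-- encoder 2 -/
  enc₂ : Fin M₁ → Fin M₂ → Fin n → X₂
  /-- decoder -/
  dec : (Fin n → Y) → Fin M₁ × Fin M₂

/-- The symbol `x_k` of user 1 when `k` is one of the `n` times of the block, and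
the arbitrary symbol `w_k` otherwise. -/
def extend {X₁ : Type*} {n : ℕ} (x : Fin n → X₁) (w : ℤ → X₁) (k : ℤ) : X₁ :=
  if h : 0 ≤ k ∧ k < n then x ⟨k.toNat, by omega⟩ else w k

section Coding

variable {X₁ X₂ Y : Type*} [Fintype Y]

/-- `P_d(y | x₁, x₂) = ∏_i P(y_i | x_{1,i-d}, x_{2,i})`, where `w` provides the
symbols `x_{1,i-d}` with `i - d` outside of the block. -/
def transProb (W : X₁ → X₂ → stdSimplex ℝ Y) {n : ℕ} (d : ℤ) (w : ℤ → X₁)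
    (x₁ : Fin n → X₁) (x₂ : Fin n → X₂) (y : Fin n → Y) : ℝ :=
  ∏ i : Fin n, W (extend x₁ w ((i : ℤ) - d)) (x₂ i) (y i)

open Classical in
/-- The average probability of error for the delay `d`. The symbols `w` outside of the block
are arbitrary, and may differ from one pair of messages to another. -/
def avgError (W : X₁ → X₂ → stdSimplex ℝ Y) {M₁ M₂ n : ℕ} (c : Code X₁ X₂ Y M₁ M₂ n)
    (d : ℤ) (w : Fin M₁ → Fin M₂ → ℤ → X₁) : ℝ :=
  1 / ((M₁ : ℝ) * (M₂ : ℝ)) * ∑ m₁, ∑ m₂,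
    ∑ y : Fin n → Y with c.dec y ≠ (m₁, m₂),
      transProb W d (w m₁ m₂) (c.enc₁ m₁) (c.enc₂ m₁ m₂) y

/-- The average probability of error is at most `ε` for every delay, whatever
the symbols outside of the block are. -/
def IsEpsCode (W : X₁ → X₂ → stdSimplex ℝ Y) (dMin dMax : ℕ) {M₁ M₂ n : ℕ}
    (c : Code X₁ X₂ Y M₁ M₂ n) (ε : ℝ) : Prop :=
  ∀ (d : Delay dMin dMax) (w : Fin M₁ → Fin M₂ → ℤ → X₁), avgError W c d.1 w ≤ ε

/-- A pair of nonnegative rates is achievable if there are `(2^{nR₁}, 2^{nR₂}, n, ε_n)`-codes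
(numbers of messages rounded up to integers) with `ε_n → 0`. -/
def Achievable (W : X₁ → X₂ → stdSimplex ℝ Y) (dMin dMax : ℕ) (R : ℝ × ℝ) : Prop :=
  0 ≤ R.1 ∧ 0 ≤ R.2 ∧ ∃ ε : ℕ → ℝ, Tendsto ε atTop (𝓝 0) ∧
    ∀ n : ℕ, ∃ c : Code X₁ X₂ Y
        ⌈(2 : ℝ) ^ ((n : ℝ) * R.1)⌉₊ ⌈(2 : ℝ) ^ ((n : ℝ) * R.2)⌉₊ n,
      IsEpsCode W dMin dMax c (ε n)

/-- The capacity region: the closure of the set of achievable rate pairs. -/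
def capacityRegion (W : X₁ → X₂ → stdSimplex ℝ Y) (dMin dMax : ℕ) : Set (ℝ × ℝ) :=
  closure {R : ℝ × ℝ | Achievable W dMin dMax R}

end Coding

end ACMAC

end

/-! Superposition coding over sliding windows. The first codeword has independent symbols. Encoder 2
knows all of it and draws its symbol at time i from P(x₂|v), with v the first codeword at the
positions i-dMax, …, i+dMin. This window contains x_{1,i-d} for every delay d, so one codebook
serves all delays.

For each d the decoder tests whether the products over time of `ratio₂` and of `ratio₁ * ratio₂`
reach thresholds slightly below 2 to the accumulated informations, and it returns the only message
pair that passes a test for some d. A wrong pair is excluded by Markov's inequality: these products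
have mean at most 1 over a fresh codeword, for every fixed output sequence, so the law of the output
is not needed (`ex_encLaw_windowTest_le`, `ex_ex_windowTest_le`). The right pair passes by
Chebyshev's inequality: information densities at times with disjoint windows are uncorrelated, and
each window meets boundedly many others (`ex_windows_lt_le`). Summing the errors over the finitely
many delays yields one deterministic code for all of them (`exists_code_of_tests`).

Convex combinations come from time sharing: the block is cut into segments proportional to the
weights, and the decoder discards the times whose window leaves a segment (`Interior`). This loses a
bounded number of times, and it makes the arbitrary symbols irrelevant (`avgError_interiorCode`).
Scaling a point towards the origin supplies the slack in the rates, and the closure recovers the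
point. -/

noncomputable section

namespace ACMAC

/-! ### Expectations with respect to weights on finite types -/

section Expectation

variable {α β ι κ J S : Type*} [Fintype α] [Fintype β] [Fintype ι] [Fintype κ]
  [Fintype J] [Fintype S]

/-- The expectation of `F` under the weights `P`. -/
def ex (P : α → ℝ) (F : α → ℝ) : ℝ := ∑ x, P x * F x

/-- The product weights of a family of weights. -/
def piWeight (a : J → S → ℝ) (y : J → S) : ℝ := ∏ j, a j (y j)

open Classical in
/-- The indicator of a proposition as a real number. -/
def ind (p : Prop) : ℝ := if p then 1 else 0

theorem ind_nonneg (p : Prop) : 0 ≤ ind p := by unfold ind; split_ifs <;> norm_num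

theorem ind_le_one (p : Prop) : ind p ≤ 1 := by unfold ind; split_ifs <;> norm_num

theorem ind_true {p : Prop} (h : p) : ind p = 1 := by simp [ind, h]

theorem ind_false {p : Prop} (h : ¬p) : ind p = 0 := by simp [ind, h]

theorem ex_mono {P F G : α → ℝ} (hP : ∀ x, 0 ≤ P x) (h : ∀ x, F x ≤ G x) : ex P F ≤ ex P G :=
  Finset.sum_le_sum fun x _ => mul_le_mul_of_nonneg_left (h x) (hP x)

theorem ex_mono_of_pos {P F G : α → ℝ} (hP : ∀ x, 0 ≤ P x) (h : ∀ x, 0 < P x → F x ≤ G x) :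
    ex P F ≤ ex P G := by
  refine Finset.sum_le_sum fun x _ => ?_
  rcases (hP x).eq_or_lt with h0 | h0
  · simp [← h0]
  · exact mul_le_mul_of_nonneg_left (h x h0) (hP x)

theorem ex_nonneg {P F : α → ℝ} (hP : ∀ x, 0 ≤ P x) (h : ∀ x, 0 ≤ F x) : 0 ≤ ex P F :=
  Finset.sum_nonneg fun x _ => mul_nonneg (hP x) (h x)

theorem ex_add (P F G : α → ℝ) : ex P (fun x => F x + G x) = ex P F + ex P G := by
  simp [ex, mul_add, Finset.sum_add_distrib]

omit [Fintype ι] in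
theorem ex_sum (P : α → ℝ) (s : Finset ι) (F : ι → α → ℝ) :
    ex P (fun x => ∑ i ∈ s, F i x) = ∑ i ∈ s, ex P (F i) := by
  simp only [ex, Finset.mul_sum]
  exact Finset.sum_comm

theorem ex_const_mul (P F : α → ℝ) (c : ℝ) : ex P (fun x => c * F x) = c * ex P F := by
  simp only [ex, Finset.mul_sum]
  exact Finset.sum_congr rfl fun x _ => by ring

theorem ex_mul_const (P F : α → ℝ) (c : ℝ) : ex P (fun x => F x * c) = ex P F * c := by
  simp only [ex, Finset.sum_mul]
  exact Finset.sum_congr rfl fun x _ => by ring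

theorem ex_const {P : α → ℝ} (hP : P ∈ stdSimplex ℝ α) (c : ℝ) : ex P (fun _ => c) = c := by
  simp [ex, ← Finset.sum_mul, hP.2]

theorem ex_le_const {P F : α → ℝ} (hP : P ∈ stdSimplex ℝ α) {c : ℝ} (h : ∀ x, F x ≤ c) :
    ex P F ≤ c :=
  (ex_mono hP.1 h).trans_eq (ex_const hP c)

theorem ex_comm (P : α → ℝ) (Q : β → ℝ) (F : α → β → ℝ) :
    ex P (fun x => ex Q fun y => F x y) = ex Q fun y => ex P fun x => F x y := by
  simp only [ex, Finset.mul_sum]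
  rw [Finset.sum_comm]
  exact Finset.sum_congr rfl fun x _ => Finset.sum_congr rfl fun x _ => by ring

theorem exists_le_of_ex_le {P F : α → ℝ} (hP : P ∈ stdSimplex ℝ α) {c : ℝ} (h : ex P F ≤ c) :
    ∃ x, F x ≤ c := by
  by_contra! hc
  have h1 : ∀ x ∈ Finset.univ, 0 ≤ P x * (F x - c) := fun x _ =>
    mul_nonneg (hP.1 x) (sub_nonneg.2 (hc x).le)
  have h2 : ∑ x, P x * (F x - c) = ex P F - c := by
    simp [ex, mul_sub, Finset.sum_sub_distrib, ← Finset.sum_mul, hP.2]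
  have h3 : ∑ x, P x * (F x - c) = 0 :=
    le_antisymm (by linarith) (Finset.sum_nonneg h1)
  rw [Finset.sum_eq_zero_iff_of_nonneg h1] at h3
  have h4 : ∑ x, P x = 0 := Finset.sum_eq_zero fun x hx => by
    rcases mul_eq_zero.1 (h3 x hx) with h | h
    · exact h
    · exact absurd (hc x) (by linarith)
  linarith [hP.2]

theorem ex_prod_eq (P : α → ℝ) (Q : α → β → ℝ) (F : α × β → ℝ) :
    ex (fun c : α × β => P c.1 * Q c.1 c.2) F = ex P fun a => ex (Q a) fun b => F (a, b) := by
  simp only [ex, Fintype.sum_prod_type, Finset.mul_sum]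
  exact Finset.sum_congr rfl fun x _ => Finset.sum_congr rfl fun x _ => by ring

theorem prod_mem_stdSimplex {P : α → ℝ} {Q : α → β → ℝ} (hP : P ∈ stdSimplex ℝ α)
    (hQ : ∀ a, Q a ∈ stdSimplex ℝ β) :
    (fun c : α × β => P c.1 * Q c.1 c.2) ∈ stdSimplex ℝ (α × β) := by
  refine ⟨fun c => mul_nonneg (hP.1 _) ((hQ _).1 _), ?_⟩
  simp [Fintype.sum_prod_type, ← Finset.mul_sum, (hQ _).2, hP.2]

theorem ex_piWeight_prod [DecidableEq J] (a f : J → S → ℝ) :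
    ex (piWeight a) (fun y => ∏ j, f j (y j)) = ∏ j, ex (a j) (f j) := by
  simp only [ex, piWeight, ← Finset.prod_mul_distrib]
  exact (Fintype.prod_sum fun j s => a j s * f j s).symm

theorem piWeight_mem_stdSimplex [DecidableEq J] {a : J → S → ℝ}
    (ha : ∀ j, a j ∈ stdSimplex ℝ S) : piWeight a ∈ stdSimplex ℝ (J → S) := by
  refine ⟨fun y => Finset.prod_nonneg fun j _ => (ha j).1 _, ?_⟩
  have := Fintype.prod_sum a
  simp only [(ha _).2, Finset.prod_const_one] at this
  exact this.symm

omit [Fintype S] in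
theorem pos_of_piWeight_pos {a : J → S → ℝ} (ha : ∀ j s, 0 ≤ a j s) {y : J → S}
    (h : 0 < piWeight a y) (j : J) : 0 < a j (y j) := by
  refine (ha j _).lt_of_ne' fun h0 => ?_
  exact h.ne' (Finset.prod_eq_zero (Finset.mem_univ j) h0)

/-- Marginalization: a function of the coordinates selected by an injection. -/
theorem ex_piWeight_comp [DecidableEq J] [DecidableEq ι] {a : J → S → ℝ}
    (ha : ∀ j, ∑ s, a j s = 1) {φ : ι → J} (hφ : Function.Injective φ) (F : (ι → S) → ℝ) :
    ex (piWeight a) (fun y => F (y ∘ φ)) = ex (piWeight fun i => a (φ i)) F := by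
  classical
  have key : ∀ u : ι → S, ∑ y : J → S, piWeight a y * (if y ∘ φ = u then 1 else 0) =
      piWeight (fun i => a (φ i)) u := by
    intro u
    -- The indicator of `y ∘ φ = u` is a product over all coordinates. The factor is constantly 1
    -- off the range of `φ`, and injectivity leaves a single constraint at each point of the range.
    set f : J → S → ℝ := fun j s => if ∀ i, φ i = j → s = u i then 1 else 0 with hf
    have h1 : ∀ y : J → S, (if y ∘ φ = u then (1 : ℝ) else 0) = ∏ j, f j (y j) := by
      intro y
      simp only [hf]
      rw [Finset.prod_ite_zero]
      simp only [Finset.prod_const_one, Finset.mem_univ, forall_const]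
      congr 1
      simp only [funext_iff, Function.comp_apply, eq_iff_iff]
      exact ⟨fun h j i hi => hi ▸ h i, fun h i => h _ i rfl⟩
    simp only [h1]
    change ex (piWeight a) (fun y => ∏ j, f j (y j)) = _
    rw [ex_piWeight_prod]
    have h2 : ∀ j, j ∉ Set.range φ → ex (a j) (f j) = 1 := by
      intro j hj
      have : ∀ s, f j s = 1 := fun s => by
        simp only [hf]
        rw [if_pos]
        intro i hi
        exact absurd ⟨i, hi⟩ hj
      simp [ex, this, ha]
    have h3 : ∀ i, ex (a (φ i)) (f (φ i)) = a (φ i) (u i) := by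
      intro i
      have : ∀ s, f (φ i) s = if s = u i then 1 else 0 := fun s => by
        simp only [hf]
        congr 1
        simp only [eq_iff_iff]
        exact ⟨fun h => h i rfl, fun h i' hi' => by rw [hφ hi', h]⟩
      simp [ex, this]
    rw [piWeight, ← Finset.prod_congr rfl fun i _ => h3 i]
    rw [← Finset.prod_image (s := Finset.univ) (g := φ) (f := fun j => ex (a j) (f j))
      fun x _ y _ h => hφ h]
    symm
    apply Finset.prod_subset (Finset.subset_univ _)
    intro j _ hj
    apply h2
    simpa using hj
  simp only [ex, ← key, Finset.sum_mul]
  rw [Finset.sum_comm]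
  refine Finset.sum_congr rfl fun y _ => ?_
  simp

theorem ex_piWeight_one [DecidableEq J] {a : J → S → ℝ} (ha : ∀ j, ∑ s, a j s = 1) (j : J)
    (F : S → ℝ) : ex (piWeight a) (fun y => F (y j)) = ex (a j) F := by
  have := ex_piWeight_comp ha (φ := fun _ : Unit => j) (fun _ _ _ => rfl) fun u => F (u ())
  simp only [Function.comp_apply] at this
  rw [this]
  simp only [ex, piWeight, Finset.univ_unique, Finset.prod_singleton]
  exact Fintype.sum_equiv (Equiv.funUnique Unit S) _ _ fun x => rfl

/-- Disjoint sets of coordinates are independent: this is marginalization along `Sum.elim φ ψ`,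
which is injective because the ranges are disjoint. -/
theorem ex_piWeight_sumElim [DecidableEq J] [DecidableEq ι] [DecidableEq κ] {a : J → S → ℝ}
    (ha : ∀ j, ∑ s, a j s = 1) {φ : ι → J} {ψ : κ → J} (hφ : Function.Injective φ)
    (hψ : Function.Injective ψ) (h : ∀ i k, φ i ≠ ψ k) (F : (ι → S) → (κ → S) → ℝ) :
    ex (piWeight a) (fun y => F (y ∘ φ) (y ∘ ψ)) =
      ex (piWeight fun i => a (φ i)) fun u => ex (piWeight fun k => a (ψ k)) fun v => F u v := by
  have := ex_piWeight_comp ha (φ := Sum.elim φ ψ) (hφ.sumElim hψ h)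
    fun u => F (u ∘ Sum.inl) (u ∘ Sum.inr)
  have e : ∀ y : J → S, (y ∘ Sum.elim φ ψ) ∘ Sum.inl = y ∘ φ ∧
      (y ∘ Sum.elim φ ψ) ∘ Sum.inr = y ∘ ψ := fun y => ⟨rfl, rfl⟩
  simp only [(e _).1, (e _).2] at this
  rw [this]
  simp only [ex, Finset.mul_sum]
  rw [← Fintype.sum_prod_type']
  refine Fintype.sum_equiv (Equiv.sumArrowEquivProdArrow ι κ S) _ _ fun y => ?_
  simp only [piWeight, Fintype.prod_sum_type, Equiv.sumArrowEquivProdArrow, Sum.elim_inl,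
    Sum.elim_inr, Equiv.coe_fn_mk, Function.comp_apply, mul_assoc]

theorem ex_piWeight_two [DecidableEq J] {a : J → S → ℝ} (ha : ∀ j, ∑ s, a j s = 1) {j k : J}
    (hjk : j ≠ k) (F : S → S → ℝ) :
    ex (piWeight a) (fun y => F (y j) (y k)) = ex (a j) fun s => ex (a k) fun t => F s t := by
  have := ex_piWeight_sumElim ha (φ := fun _ : Unit => j) (ψ := fun _ : Unit => k)
    (fun _ _ _ => rfl) (fun _ _ _ => rfl) (fun _ _ => hjk) fun u v => F (u ()) (v ())
  simp only [Function.comp_apply] at this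
  rw [this]
  have e : ∀ (b : S → ℝ) (G : S → ℝ), ex (piWeight fun _ : Unit => b) (fun u => G (u ())) =
      ex b G := by
    intro b G
    simp only [ex, piWeight, Finset.univ_unique, Finset.prod_singleton]
    exact Fintype.sum_equiv (Equiv.funUnique Unit S) _ _ fun x => rfl
  rw [← e]
  congr 1
  funext u
  rw [← e]

end Expectation

/-! ### Random coding for a compound channel with a cognitive encoder -/

section RandomCoding

variable {A B O Δ : Type*} [Fintype A] [Fintype B] [Fintype O] [Fintype Δ]

/-- The weights of a random family of codewords `(a, b₁, …, b_M)`. -/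
def codewordWeight (P : A → ℝ) (Q : A → B → ℝ) (M : ℕ) (c : A × (Fin M → B)) : ℝ :=
  P c.1 * piWeight (fun _ => Q c.1) c.2

theorem codewordWeight_mem {P : A → ℝ} {Q : A → B → ℝ} (hP : P ∈ stdSimplex ℝ A)
    (hQ : ∀ a, Q a ∈ stdSimplex ℝ B) (M : ℕ) :
    codewordWeight P Q M ∈ stdSimplex ℝ (A × (Fin M → B)) :=
  prod_mem_stdSimplex hP fun a => piWeight_mem_stdSimplex fun _ => hQ a

theorem ex_codewordWeight_one {P : A → ℝ} {Q : A → B → ℝ}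
    (hQ : ∀ a, Q a ∈ stdSimplex ℝ B) {M : ℕ} (m : Fin M) (F : A → B → ℝ) :
    ex (codewordWeight P Q M) (fun c => F c.1 (c.2 m)) =
      ex P fun a => ex (Q a) fun b => F a b := by
  have := ex_prod_eq P (fun a => piWeight fun _ : Fin M => Q a) fun c => F c.1 (c.2 m)
  refine this.trans ?_
  congr 1
  funext a
  exact ex_piWeight_one (fun _ => (hQ a).2) m (F a)

theorem ex_codewordWeight_two {P : A → ℝ} {Q : A → B → ℝ}
    (hQ : ∀ a, Q a ∈ stdSimplex ℝ B) {M : ℕ} {m m' : Fin M} (h : m ≠ m') (F : A → B → B → ℝ) :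
    ex (codewordWeight P Q M) (fun c => F c.1 (c.2 m) (c.2 m')) =
      ex P fun a => ex (Q a) fun b => ex (Q a) fun b' => F a b b' := by
  have := ex_prod_eq P (fun a => piWeight fun _ : Fin M => Q a) fun c => F c.1 (c.2 m) (c.2 m')
  refine this.trans ?_
  congr 1
  funext a
  exact ex_piWeight_two (fun _ => (hQ a).2) h (F a)

/-- The message pair `m` is the only one that passes one of the tests. -/
def UniquelyPasses (T : Δ → A → B → O → Prop) {M₁ M₂ : ℕ} (C : Fin M₁ → A × (Fin M₂ → B))
    (o : O) (m : Fin M₁ × Fin M₂) : Prop :=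
  (∃ d, T d (C m.1).1 ((C m.1).2 m.2) o) ∧
    ∀ m' : Fin M₁ × Fin M₂, m' ≠ m → ∀ d, ¬T d (C m'.1).1 ((C m'.1).2 m'.2) o

open Classical in
/-- The decoder that looks for a message pair that is the only one to pass one of the tests. -/
def testDecoder (T : Δ → A → B → O → Prop) {M₁ M₂ : ℕ} (m₀ : Fin M₁ × Fin M₂)
    (C : Fin M₁ → A × (Fin M₂ → B)) (o : O) : Fin M₁ × Fin M₂ :=
  if h : ∃ m, UniquelyPasses T C o m then h.choose else m₀

omit [Fintype A] [Fintype B] [Fintype O] in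
-- Union bound. The right pair needs to pass only the test of the true delay, but a wrong pair does
-- harm by passing the test of any delay.
theorem ind_testDecoder_ne_le (T : Δ → A → B → O → Prop) {M₁ M₂ : ℕ} (m₀ : Fin M₁ × Fin M₂)
    (C : Fin M₁ → A × (Fin M₂ → B)) (o : O) (m : Fin M₁ × Fin M₂) (d : Δ) :
    ind (testDecoder T m₀ C o ≠ m) ≤ ind (¬T d (C m.1).1 ((C m.1).2 m.2) o) +
      ∑ m' ∈ Finset.univ.erase m, ∑ d', ind (T d' (C m'.1).1 ((C m'.1).2 m'.2) o) := by
  have hs : ∀ s : Finset (Fin M₁ × Fin M₂),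
      0 ≤ ∑ m' ∈ s, ∑ d', ind (T d' (C m'.1).1 ((C m'.1).2 m'.2) o) := fun s =>
    Finset.sum_nonneg fun _ _ => Finset.sum_nonneg fun _ _ => ind_nonneg _
  by_cases h1 : T d (C m.1).1 ((C m.1).2 m.2) o
  · by_cases h2 : ∃ m', m' ≠ m ∧ ∃ d', T d' (C m'.1).1 ((C m'.1).2 m'.2) o
    · obtain ⟨m', hm', d', hd'⟩ := h2
      refine (ind_le_one _).trans ?_
      rw [ind_false (not_not.2 h1), zero_add]
      calc (1 : ℝ) = ind (T d' (C m'.1).1 ((C m'.1).2 m'.2) o) := (ind_true hd').symm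
        _ ≤ ∑ d', ind (T d' (C m'.1).1 ((C m'.1).2 m'.2) o) :=
          Finset.single_le_sum (f := fun d' => ind (T d' (C m'.1).1 ((C m'.1).2 m'.2) o))
            (fun _ _ => ind_nonneg _) (Finset.mem_univ d')
        _ ≤ _ := Finset.single_le_sum
          (f := fun m' : Fin M₁ × Fin M₂ => ∑ d', ind (T d' (C m'.1).1 ((C m'.1).2 m'.2) o))
            (fun _ _ => Finset.sum_nonneg fun _ _ => ind_nonneg _)
            (Finset.mem_erase.2 ⟨hm', Finset.mem_univ _⟩)
    · push Not at h2
      have hu : UniquelyPasses T C o m := ⟨⟨d, h1⟩, h2⟩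
      have hex : ∃ m, UniquelyPasses T C o m := ⟨m, hu⟩
      have : testDecoder T m₀ C o = m := by
        rw [testDecoder, dif_pos hex]
        by_contra hne
        obtain ⟨d', hd'⟩ := hex.choose_spec.1
        exact h2 _ hne d' hd'
      rw [ind_false (not_not.2 this)]
      exact add_nonneg (ind_nonneg _) (hs _)
  · rw [ind_true h1]
    linarith [ind_le_one (testDecoder T m₀ C o ≠ m), hs (Finset.univ.erase m)]

/-- Counts the competitors of a message pair by whether they share its first message. -/
theorem sum_erase_pair (M₁ M₂ : ℕ) (m : Fin M₁ × Fin M₂) (β γ : ℝ) :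
    ∑ m' ∈ Finset.univ.erase m, (if m'.1 = m.1 then β else γ) =
      ((M₂ : ℝ) - 1) * β + ((M₁ : ℝ) - 1) * M₂ * γ := by
  have h1 : ∑ m' : Fin M₁ × Fin M₂, (if m'.1 = m.1 then β else γ) =
      M₂ * β + ((M₁ : ℝ) - 1) * M₂ * γ := by
    have : ∀ m' : Fin M₁ × Fin M₂, (if m'.1 = m.1 then β else γ) =
        γ + if m'.1 = m.1 then β - γ else 0 := fun m' => by split_ifs <;> ring
    simp only [this, Finset.sum_add_distrib, Fintype.sum_prod_type]
    rw [Finset.sum_comm (s := Finset.univ (α := Fin M₁)) (t := Finset.univ (α := Fin M₂))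
      (f := fun x _ => if x = m.1 then β - γ else 0)]
    simp
    ring
  have h2 := Finset.sum_erase_add Finset.univ (fun m' : Fin M₁ × Fin M₂ =>
    if m'.1 = m.1 then β else γ) (Finset.mem_univ m)
  simp only [if_true] at h2
  linarith

/-- The random coding bound: for suitable tests there is a code whose average error is small
for all channels of a finite family. -/
theorem exists_code_of_tests {P : A → ℝ} {Q : A → B → ℝ} {V : Δ → A → B → O → ℝ}
    (hP : P ∈ stdSimplex ℝ A) (hQ : ∀ a, Q a ∈ stdSimplex ℝ B)
    (hV : ∀ d a b, V d a b ∈ stdSimplex ℝ O) (T : Δ → A → B → O → Prop) {α β γ : ℝ}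
    (h₁ : ∀ d, ex P (fun a => ex (Q a) fun b => ex (V d a b) fun o => ind (¬T d a b o)) ≤ α)
    (h₂ : ∀ d a o, ex (Q a) (fun b => ind (T d a b o)) ≤ β)
    (h₃ : ∀ d o, ex P (fun a => ex (Q a) fun b => ind (T d a b o)) ≤ γ)
    {M₁ M₂ : ℕ} (hM₁ : 0 < M₁) (hM₂ : 0 < M₂) :
    ∃ (x₁ : Fin M₁ → A) (x₂ : Fin M₁ → Fin M₂ → B) (dec : O → Fin M₁ × Fin M₂), ∀ d,
      1 / ((M₁ : ℝ) * M₂) * ∑ m₁, ∑ m₂,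
        ex (V d (x₁ m₁) (x₂ m₁ m₂)) (fun o => ind (dec o ≠ (m₁, m₂))) ≤
      Fintype.card Δ * (α + Fintype.card Δ *
        (((M₂ : ℝ) - 1) * β + ((M₁ : ℝ) - 1) * M₂ * γ)) := by
  set δ : ℝ := (Fintype.card Δ : ℝ)
  set bd : ℝ := α + δ * (((M₂ : ℝ) - 1) * β + ((M₁ : ℝ) - 1) * M₂ * γ)
  set π := codewordWeight P Q M₂
  have hπ : π ∈ stdSimplex ℝ _ := codewordWeight_mem hP hQ M₂
  have hcode : piWeight (fun _ : Fin M₁ => π) ∈ stdSimplex ℝ _ :=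
    piWeight_mem_stdSimplex fun _ => hπ
  set m₀ : Fin M₁ × Fin M₂ := (⟨0, hM₁⟩, ⟨0, hM₂⟩)
  let err : (Fin M₁ → A × (Fin M₂ → B)) → Δ → Fin M₁ × Fin M₂ → ℝ := fun C d m =>
    ex (V d (C m.1).1 ((C m.1).2 m.2)) (fun o => ind (testDecoder T m₀ C o ≠ m))
  -- A competitor with the same first message shares `a`, and its `b'` is independent of `b` given
  -- `a`. Any other competitor is independent of the transmitted codewords. Either way it is
  -- independent of the output given what was sent, so the bounds uniform in `o` apply.
  have hpair : ∀ d d' (m m' : Fin M₁ × Fin M₂), m' ≠ m →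
      ex (piWeight fun _ : Fin M₁ => π) (fun C => ex (V d (C m.1).1 ((C m.1).2 m.2))
        fun o => ind (T d' (C m'.1).1 ((C m'.1).2 m'.2) o)) ≤
      if m'.1 = m.1 then β else γ := by
    intro d d' m m' hne
    split_ifs with hm
    · have hm2 : m.2 ≠ m'.2 := fun h => hne (Prod.ext hm h.symm)
      rw [hm, ex_piWeight_one (fun _ => hπ.2) m.1 fun c => ex (V d c.1 (c.2 m.2))
        fun o => ind (T d' c.1 (c.2 m'.2) o),
        ex_codewordWeight_two hQ hm2 fun a b b' => ex (V d a b) fun o => ind (T d' a b' o)]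
      refine ex_le_const hP fun a => ex_le_const (hQ a) fun b => ?_
      rw [ex_comm]
      exact ex_le_const (hV d a b) fun o => h₂ d' a o
    · rw [ex_piWeight_two (fun _ => hπ.2) (Ne.symm hm) fun c c' => ex (V d c.1 (c.2 m.2))
        fun o => ind (T d' c'.1 (c'.2 m'.2) o)]
      refine ex_le_const hπ fun c => ?_
      rw [ex_comm]
      refine ex_le_const (hV _ _ _) fun o => ?_
      rw [ex_codewordWeight_one hQ m'.2 fun a b => ind (T d' a b o)]
      exact h₃ d' o
  have herr : ∀ d m, ex (piWeight fun _ : Fin M₁ => π) (fun C => err C d m) ≤ bd := by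
    intro d m
    have hle : ∀ C, err C d m ≤
        ex (V d (C m.1).1 ((C m.1).2 m.2)) (fun o => ind (¬T d (C m.1).1 ((C m.1).2 m.2) o)) +
        ∑ m' ∈ Finset.univ.erase m, ∑ d', ex (V d (C m.1).1 ((C m.1).2 m.2))
          fun o => ind (T d' (C m'.1).1 ((C m'.1).2 m'.2) o) := by
      intro C
      simp only [← ex_sum, ← ex_add]
      exact ex_mono (hV _ _ _).1 fun o => ind_testDecoder_ne_le T m₀ C o m d
    refine (ex_mono hcode.1 hle).trans ?_
    rw [ex_add]
    simp only [ex_sum]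
    refine add_le_add ?_ ?_
    · rw [ex_piWeight_one (fun _ => hπ.2) m.1 fun c => ex (V d c.1 (c.2 m.2))
        fun o => ind (¬T d c.1 (c.2 m.2) o),
        ex_codewordWeight_one hQ m.2 fun a b => ex (V d a b) fun o => ind (¬T d a b o)]
      exact h₁ d
    · rw [← sum_erase_pair M₁ M₂ m, Finset.mul_sum]
      refine Finset.sum_le_sum fun m' hm' => ?_
      refine (Finset.sum_le_sum fun d' _ =>
        hpair d d' m m' (Finset.ne_of_mem_erase hm')).trans_eq ?_
      simp [δ]
  have hM : (0 : ℝ) < (M₁ : ℝ) * M₂ := by positivity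
  have hav : ∀ d, ex (piWeight fun _ : Fin M₁ => π) (fun C => 1 / ((M₁ : ℝ) * M₂) *
      ∑ m₁, ∑ m₂, err C d (m₁, m₂)) ≤ bd := by
    intro d
    rw [ex_const_mul, one_div, inv_mul_le_iff₀ hM]
    simp only [ex_sum]
    refine (Finset.sum_le_sum fun m₁ _ => Finset.sum_le_sum fun m₂ _ => herr d _).trans_eq ?_
    simp [mul_assoc]
  -- Averaging separately for each `d` could select different codebooks. A codebook with a small sum
  -- over `d` is good for every `d`, at the cost of a factor `δ`.
  have htot : ex (piWeight fun _ : Fin M₁ => π) (fun C => ∑ d, 1 / ((M₁ : ℝ) * M₂) *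
      ∑ m₁, ∑ m₂, err C d (m₁, m₂)) ≤ δ * bd := by
    rw [ex_sum]
    refine (Finset.sum_le_sum fun d _ => hav d).trans_eq ?_
    simp [δ]
  obtain ⟨C, hC⟩ := exists_le_of_ex_le hcode htot
  refine ⟨fun m => (C m).1, fun m m' => (C m).2 m', testDecoder T m₀ C, fun d => ?_⟩
  refine le_trans ?_ hC
  refine Finset.single_le_sum (f := fun d => 1 / ((M₁ : ℝ) * M₂) *
      ∑ m₁, ∑ m₂, err C d (m₁, m₂)) (fun d _ => ?_) (Finset.mem_univ d)
  refine mul_nonneg (by positivity) (Finset.sum_nonneg fun _ _ => Finset.sum_nonneg fun _ _ => ?_)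
  exact ex_nonneg (hV _ _ _).1 fun _ => ind_nonneg _

end RandomCoding

/-! ### The weak law of large numbers for functions of overlapping windows -/

section WeakLaw

variable {J K E S Z : Type*} [Fintype J] [Fintype K] [Fintype E] [Fintype S] [Fintype Z]
  [DecidableEq J] [DecidableEq K] [DecidableEq E] [Nonempty E]

/-- Given `x`, the coordinates `z k` and `z k'` are independent, so the conditional mean of the
product splits into functions of two disjoint, hence independent, windows, each with mean zero. -/
theorem ex_windows_mul_eq_zero {p : J → S → ℝ} (hp : ∀ j, p j ∈ stdSimplex ℝ S)
    {e : K → E → J} (he : ∀ k, Function.Injective (e k))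
    {r : K → (E → S) → Z → ℝ} (hr : ∀ k v, r k v ∈ stdSimplex ℝ Z) {g : K → (E → S) → Z → ℝ}
    (hg : ∀ k, ex (piWeight fun i => p (e k i)) (fun v => ex (r k v) (g k v)) = 0) {k k' : K}
    (hk : ∀ i i', e k i ≠ e k' i') :
    ex (piWeight p) (fun x => ex (piWeight fun k => r k (x ∘ e k)) fun z =>
      g k (x ∘ e k) (z k) * g k' (x ∘ e k') (z k')) = 0 := by
  have hne : k ≠ k' := by
    rintro rfl
    exact hk (Classical.arbitrary E) (Classical.arbitrary E) rfl
  have h1 : ∀ x : J → S, ex (piWeight fun k => r k (x ∘ e k)) (fun z =>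
      g k (x ∘ e k) (z k) * g k' (x ∘ e k') (z k')) =
      ex (r k (x ∘ e k)) (g k (x ∘ e k)) * ex (r k' (x ∘ e k')) (g k' (x ∘ e k')) := by
    intro x
    rw [ex_piWeight_two (fun k => (hr k _).2) hne
      fun z z' => g k (x ∘ e k) z * g k' (x ∘ e k') z']
    simp only [ex_const_mul, ex_mul_const]
  simp only [h1]
  rw [ex_piWeight_sumElim (fun j => (hp j).2) (he k) (he k') hk
    fun v v' => ex (r k v) (g k v) * ex (r k' v') (g k' v')]
  simp only [ex_const_mul, hg, mul_zero]
  simp [ex]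

/-- In the expanded square only the pairs with overlapping windows survive: at most `C` for each
`k`, each contributing at most `B ^ 2`. -/
theorem ex_windows_sq_le {p : J → S → ℝ} (hp : ∀ j, p j ∈ stdSimplex ℝ S)
    {e : K → E → J} (he : ∀ k, Function.Injective (e k))
    {r : K → (E → S) → Z → ℝ} (hr : ∀ k v, r k v ∈ stdSimplex ℝ Z) {g : K → (E → S) → Z → ℝ}
    (hg : ∀ k, ex (piWeight fun i => p (e k i)) (fun v => ex (r k v) (g k v)) = 0)
    {B : ℝ} (hB : ∀ k v z, |g k v z| ≤ B) {C : ℕ}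
    (hC : ∀ k, {k' | ¬∀ i i', e k i ≠ e k' i'}.ncard ≤ C) :
    ex (piWeight p) (fun x => ex (piWeight fun k => r k (x ∘ e k)) fun z =>
      (∑ k, g k (x ∘ e k) (z k)) ^ 2) ≤ Fintype.card K * (C * B ^ 2) := by
  classical
  have hsq : ∀ (x : J → S) (z : K → Z), (∑ k, g k (x ∘ e k) (z k)) ^ 2 =
      ∑ k, ∑ k', g k (x ∘ e k) (z k) * g k' (x ∘ e k') (z k') := by
    intro x z
    rw [sq, Finset.sum_mul_sum]
  simp only [hsq, ex_sum]
  have hpair : ∀ k k', ex (piWeight p) (fun x => ex (piWeight fun k => r k (x ∘ e k)) fun z =>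
      g k (x ∘ e k) (z k) * g k' (x ∘ e k') (z k')) ≤
      if ¬∀ i i', e k i ≠ e k' i' then B ^ 2 else 0 := by
    intro k k'
    by_cases h : ∀ i i', e k i ≠ e k' i'
    · rw [if_neg (not_not.2 h)]
      exact (ex_windows_mul_eq_zero hp he hr hg h).le
    · rw [if_pos h]
      refine ex_le_const (piWeight_mem_stdSimplex hp) fun x =>
        ex_le_const (piWeight_mem_stdSimplex fun k => hr k _) fun z => ?_
      have hB0 : 0 ≤ B := (abs_nonneg _).trans (hB k (x ∘ e k) (z k))
      calc _ ≤ |g k (x ∘ e k) (z k) * g k' (x ∘ e k') (z k')| := le_abs_self _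
        _ = |g k (x ∘ e k) (z k)| * |g k' (x ∘ e k') (z k')| := abs_mul _ _
        _ ≤ B * B := mul_le_mul (hB _ _ _) (hB _ _ _) (abs_nonneg _) hB0
        _ = B ^ 2 := (sq B).symm
  have hrow : ∀ k, ∑ k', ex (piWeight p) (fun x => ex (piWeight fun k => r k (x ∘ e k)) fun z =>
      g k (x ∘ e k) (z k) * g k' (x ∘ e k') (z k')) ≤ C * B ^ 2 := by
    intro k
    refine (Finset.sum_le_sum fun k' _ => hpair k k').trans ?_
    rw [← Finset.sum_filter, Finset.sum_const, nsmul_eq_mul]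
    refine mul_le_mul_of_nonneg_right ?_ (sq_nonneg B)
    have := hC k
    rw [Set.ncard_eq_toFinset_card'] at this
    rw [Set.toFinset_ofPred] at this
    exact_mod_cast this
  refine (Finset.sum_le_sum fun k _ => hrow k).trans_eq ?_
  simp

/-- Chebyshev's inequality for sums of functions of overlapping windows. -/
theorem ex_windows_lt_le {p : J → S → ℝ} (hp : ∀ j, p j ∈ stdSimplex ℝ S)
    {e : K → E → J} (he : ∀ k, Function.Injective (e k))
    {r : K → (E → S) → Z → ℝ} (hr : ∀ k v, r k v ∈ stdSimplex ℝ Z) (f : K → (E → S) → Z → ℝ)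
    {μ : K → ℝ}
    (hμ : ∀ k, ex (piWeight fun i => p (e k i)) (fun v => ex (r k v) (f k v)) = μ k)
    {B : ℝ} (hB : ∀ k v z, |f k v z - μ k| ≤ B) {C : ℕ}
    (hC : ∀ k, {k' | ¬∀ i i', e k i ≠ e k' i'}.ncard ≤ C) {s t : ℝ} (hs : 0 < s)
    (ht : t + s ≤ ∑ k, μ k) :
    ex (piWeight p) (fun x => ex (piWeight fun k => r k (x ∘ e k)) fun z =>
      ind (∑ k, f k (x ∘ e k) (z k) < t)) ≤ Fintype.card K * (C * B ^ 2) / s ^ 2 := by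
  have hg : ∀ k, ex (piWeight fun i => p (e k i))
      (fun v => ex (r k v) fun z => f k v z - μ k) = 0 := by
    intro k
    have h1 : ∀ v, ex (r k v) (fun z => f k v z - μ k) = ex (r k v) (f k v) + -μ k := by
      intro v
      simp only [sub_eq_add_neg]
      rw [ex_add, ex_const (hr k v)]
    simp only [h1]
    rw [ex_add, hμ, ex_const (piWeight_mem_stdSimplex fun i => hp (e k i))]
    ring
  have hv := ex_windows_sq_le hp he hr hg hB hC
  rw [le_div_iff₀ (by positivity)]
  refine le_trans ?_ hv
  simp only [← ex_mul_const]
  refine ex_mono (piWeight_mem_stdSimplex hp).1 fun x =>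
    ex_mono (piWeight_mem_stdSimplex fun k => hr k _).1 fun z => ?_
  rw [Finset.sum_sub_distrib]
  by_cases h : ∑ k, f k (x ∘ e k) (z k) < t
  · rw [ind_true h, one_mul]
    -- The centred sum lies below `-s`, so its square exceeds `s ^ 2`.
    nlinarith
  · rw [ind_false h, zero_mul]
    exact sq_nonneg _

end WeakLaw

/-! ### Likelihood ratios -/

section Ratio

variable {A B C : Type*} [Fintype A] [Fintype B]

/-- The ratio `p(a,b) / (p(a) p(b))`. -/
def mutRatio (p : A → B → ℝ) (a : A) (b : B) : ℝ :=
  p a b / ((∑ b', p a b') * (∑ a', p a' b))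

/-- The ratio `p(c) p(c,a,b) / (p(c,a) p(c,b))`. -/
def condRatio (p : C → A → B → ℝ) (c : C) (a : A) (b : B) : ℝ :=
  (∑ a', ∑ b', p c a' b') * p c a b / ((∑ b', p c a b') * (∑ a', p c a' b))

theorem mutRatio_nonneg {p : A → B → ℝ} (hp : ∀ a b, 0 ≤ p a b) (a : A) (b : B) :
    0 ≤ mutRatio p a b :=
  div_nonneg (hp a b) (mul_nonneg (Finset.sum_nonneg fun _ _ => hp _ _)
    (Finset.sum_nonneg fun _ _ => hp _ _))

theorem condRatio_nonneg {p : C → A → B → ℝ} (hp : ∀ c a b, 0 ≤ p c a b) (c : C) (a : A)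
    (b : B) : 0 ≤ condRatio p c a b :=
  div_nonneg (mul_nonneg (Finset.sum_nonneg fun _ _ => Finset.sum_nonneg fun _ _ => hp _ _ _)
    (hp c a b)) (mul_nonneg (Finset.sum_nonneg fun _ _ => hp _ _ _)
    (Finset.sum_nonneg fun _ _ => hp _ _ _))

theorem sum_pos_of_pos {p : A → ℝ} (hp : ∀ a, 0 ≤ p a) {a : A} (h : 0 < p a) : 0 < ∑ a, p a :=
  h.trans_le (Finset.single_le_sum (fun a _ => hp a) (Finset.mem_univ a))

theorem mutRatio_pos {p : A → B → ℝ} (hp : ∀ a b, 0 ≤ p a b) {a : A} {b : B} (h : 0 < p a b) :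
    0 < mutRatio p a b :=
  div_pos h (mul_pos (sum_pos_of_pos (hp a) h) (sum_pos_of_pos (fun a => hp a b) h))

theorem condRatio_pos {p : C → A → B → ℝ} (hp : ∀ c a b, 0 ≤ p c a b) {c : C} {a : A} {b : B}
    (h : 0 < p c a b) : 0 < condRatio p c a b := by
  have h1 : 0 < ∑ b', p c a b' := sum_pos_of_pos (hp c a) h
  refine div_pos (mul_pos ?_ h) (mul_pos h1 (sum_pos_of_pos (fun a => hp c a b) h))
  exact sum_pos_of_pos (p := fun a => ∑ b', p c a b')
    (fun a => Finset.sum_nonneg fun _ _ => hp _ _ _) h1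

/-- The summand is p(a|b), so the sum is 1, except that it vanishes when p(b) = 0 because division
by zero gives 0. -/
theorem sum_mul_mutRatio_le {p : A → B → ℝ} (hp : ∀ a b, 0 ≤ p a b) (b : B) :
    ∑ a, (∑ b', p a b') * mutRatio p a b ≤ 1 := by
  have h : ∀ a, (∑ b', p a b') * mutRatio p a b ≤ p a b / ∑ a', p a' b := by
    intro a
    rcases eq_or_ne (∑ b', p a b') 0 with h0 | h0
    · rw [h0, zero_mul]
      exact div_nonneg (hp a b) (Finset.sum_nonneg fun _ _ => hp _ _)
    · rw [mutRatio, ← mul_div_assoc]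
      exact (mul_div_mul_left _ _ h0).le
  refine (Finset.sum_le_sum fun a _ => h a).trans ?_
  rw [← Finset.sum_div]
  exact div_self_le_one _

/-- Here `q` plays the role of p(a|c), in a form that leaves it free when p(c) = 0. The bound
persists there since the ratio is then 0. -/
theorem sum_mul_condRatio_le {p : C → A → B → ℝ} (hp : ∀ c a b, 0 ≤ p c a b) {q : A → ℝ} {c : C}
    (hq : ∀ a, (∑ a', ∑ b', p c a' b') * q a = ∑ b, p c a b) (b : B) :
    ∑ a, q a * condRatio p c a b ≤ 1 := by
  have h : ∀ a, q a * condRatio p c a b ≤ p c a b / ∑ a', p c a' b := by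
    intro a
    rcases eq_or_ne (∑ b', p c a b') 0 with h0 | h0
    · rw [condRatio, h0, zero_mul, div_zero, mul_zero]
      exact div_nonneg (hp c a b) (Finset.sum_nonneg fun _ _ => hp _ _ _)
    · rw [condRatio, ← mul_div_assoc, ← mul_assoc, mul_comm (q a), hq]
      exact (mul_div_mul_left _ _ h0).le
  refine (Finset.sum_le_sum fun a _ => h a).trans ?_
  rw [← Finset.sum_div]
  exact div_self_le_one _

end Ratio

/-! ### Single-letter ratios of the channel and their means -/

section Scores

variable {X₁ X₂ Y : Type*} [Fintype X₁] [Fintype X₂] [Fintype Y]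

/-- The ratio `P_d(x₁,y) / (P(x₁) P_d(y))` for the joint law of the channel. -/
def ratio₁ (W : X₁ → X₂ → stdSimplex ℝ Y) {dMin dMax : ℕ}
    (p : stdSimplex ℝ X₁) (q : Window X₁ dMin dMax → stdSimplex ℝ X₂)
    (d : Delay dMin dMax) (x₁ : X₁) (y : Y) : ℝ :=
  mutRatio (fun x₁ y => ∑ v, ∑ x₂, jointLaw W p q d x₁ v x₂ y) x₁ y

/-- The ratio `P(v) P_d(v,x₂,y) / (P(v,x₂) P_d(v,y))` for the joint law of the channel. -/
def ratio₂ (W : X₁ → X₂ → stdSimplex ℝ Y) {dMin dMax : ℕ}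
    (p : stdSimplex ℝ X₁) (q : Window X₁ dMin dMax → stdSimplex ℝ X₂)
    (d : Delay dMin dMax) (v : Window X₁ dMin dMax) (x₂ : X₂) (y : Y) : ℝ :=
  condRatio (fun v x₂ y => ∑ x₁, jointLaw W p q d x₁ v x₂ y) v x₂ y

/-- The conditional law of `(X₂, Y)` given the window. -/
def pairLaw (W : X₁ → X₂ → stdSimplex ℝ Y) {dMin dMax : ℕ}
    (q : Window X₁ dMin dMax → stdSimplex ℝ X₂) (d : Delay dMin dMax)
    (v : Window X₁ dMin dMax) (z : X₂ × Y) : ℝ :=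
  q v z.1 * W (v (windowIndex d)) z.1 z.2

variable (W : X₁ → X₂ → stdSimplex ℝ Y) {dMin dMax : ℕ}
    (p : stdSimplex ℝ X₁) (q : Window X₁ dMin dMax → stdSimplex ℝ X₂)
    (d : Delay dMin dMax)

theorem coe_mem_stdSimplex {A : Type*} [Fintype A] (p : stdSimplex ℝ A) :
    (fun a => p a) ∈ stdSimplex ℝ A := p.2

omit [Fintype X₁] in
theorem pairLaw_mem (v : Window X₁ dMin dMax) : pairLaw W q d v ∈ stdSimplex ℝ (X₂ × Y) :=
  prod_mem_stdSimplex (coe_mem_stdSimplex (q v))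
    fun x₂ => coe_mem_stdSimplex (W (v (windowIndex d)) x₂)

theorem jointLaw_nonneg (x₁ : X₁) (v : Window X₁ dMin dMax) (x₂ : X₂) (y : Y) :
    0 ≤ jointLaw W p q d x₁ v x₂ y := by
  have h1 : 0 ≤ ∏ j, p (v j) := Finset.prod_nonneg fun _ _ => p.2.1 _
  have h2 : 0 ≤ q v x₂ := (q v).2.1 _
  have h3 : 0 ≤ W x₁ x₂ y := (W x₁ x₂).2.1 _
  unfold jointLaw
  split_ifs <;> positivity

theorem sum_jointLaw (v : Window X₁ dMin dMax) (x₂ : X₂) (y : Y) :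
    ∑ x₁, jointLaw W p q d x₁ v x₂ y =
      piWeight (fun _ x => p x) v * pairLaw W q d v (x₂, y) := by
  classical
  simp only [jointLaw, piWeight, pairLaw]
  rw [Finset.sum_eq_single (v (windowIndex d))]
  · simp [mul_assoc]
  · intro b _ hb
    simp [hb]
  · simp

theorem ratio₁_nonneg (x₁ : X₁) (y : Y) : 0 ≤ ratio₁ W p q d x₁ y :=
  mutRatio_nonneg (fun _ _ => Finset.sum_nonneg fun _ _ => Finset.sum_nonneg fun _ _ =>
    jointLaw_nonneg W p q d _ _ _ _) _ _

theorem ratio₂_nonneg (v : Window X₁ dMin dMax) (x₂ : X₂) (y : Y) : 0 ≤ ratio₂ W p q d v x₂ y :=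
  condRatio_nonneg (fun _ _ _ => Finset.sum_nonneg fun _ _ => jointLaw_nonneg W p q d _ _ _ _) _ _ _

/-- Positivity on the support is what later turns the logarithm of a product of ratios into a sum.
-/
theorem ratio₂_pos {v : Window X₁ dMin dMax} {x₂ : X₂} {y : Y}
    (hv : 0 < piWeight (fun _ x => p x) v) (h : 0 < pairLaw W q d v (x₂, y)) :
    0 < ratio₂ W p q d v x₂ y := by
  refine condRatio_pos (fun _ _ _ => Finset.sum_nonneg fun _ _ => jointLaw_nonneg W p q d _ _ _ _)
    ?_
  rw [sum_jointLaw]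
  exact mul_pos hv h

theorem ratio₁_pos {v : Window X₁ dMin dMax} {x₂ : X₂} {y : Y}
    (hv : 0 < piWeight (fun _ x => p x) v) (h : 0 < pairLaw W q d v (x₂, y)) :
    0 < ratio₁ W p q d (v (windowIndex d)) y := by
  refine mutRatio_pos (fun _ _ => Finset.sum_nonneg fun _ _ => Finset.sum_nonneg fun _ _ =>
    jointLaw_nonneg W p q d _ _ _ _) ?_
  have h0 : 0 < jointLaw W p q d (v (windowIndex d)) v x₂ y := by
    simp only [jointLaw, if_true, mul_one]
    rw [mul_assoc]
    exact mul_pos hv h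
  refine sum_pos_of_pos (p := fun v' => ∑ x₂, jointLaw W p q d (v (windowIndex d)) v' x₂ y)
    (a := v) (fun _ => Finset.sum_nonneg fun _ _ => jointLaw_nonneg W p q d _ _ _ _) ?_
  exact sum_pos_of_pos (fun _ => jointLaw_nonneg W p q d _ _ _ _) h0

theorem ex_ratio₂_le (v : Window X₁ dMin dMax) (y : Y) :
    ex (fun x₂ => q v x₂) (fun x₂ => ratio₂ W p q d v x₂ y) ≤ 1 := by
  refine sum_mul_condRatio_le
    (fun _ _ _ => Finset.sum_nonneg fun _ _ => jointLaw_nonneg W p q d _ _ _ _) (fun x₂ => ?_) y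
  simp only [sum_jointLaw, pairLaw, ← Finset.mul_sum]
  have h1 : ∀ x₂, ∑ y, W (v (windowIndex d)) x₂ y = 1 :=
    fun x₂ => (coe_mem_stdSimplex (W (v (windowIndex d)) x₂)).2
  have h2 : ∑ x₂, q v x₂ = 1 := (coe_mem_stdSimplex (q v)).2
  simp only [h1, mul_one, h2]

/-- X₁ is one coordinate of an i.i.d. window, so its law does not depend on which coordinate the
delay selects. -/
theorem sum_law_X₁ (x₁ : X₁) :
    ∑ y, ∑ v, ∑ x₂, jointLaw W p q d x₁ v x₂ y = p x₁ := by
  classical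
  have h1 : ∀ v : Window X₁ dMin dMax, ∑ x₂, ∑ y, jointLaw W p q d x₁ v x₂ y =
      piWeight (fun _ x => p x) v * (if x₁ = v (windowIndex d) then 1 else 0) := by
    intro v
    have h1 : ∀ x₂, ∑ y, W x₁ x₂ y = 1 := fun x₂ => (coe_mem_stdSimplex (W x₁ x₂)).2
    have h2 : ∑ x₂, q v x₂ = 1 := (coe_mem_stdSimplex (q v)).2
    simp only [jointLaw, ← Finset.mul_sum, h1, mul_one, h2]
    simp [piWeight]
  rw [Finset.sum_comm]
  have h2 : ∀ v : Window X₁ dMin dMax, ∑ y, ∑ x₂, jointLaw W p q d x₁ v x₂ y =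
      piWeight (fun _ x => p x) v * (if x₁ = v (windowIndex d) then 1 else 0) := fun v => by
    rw [Finset.sum_comm, h1]
  simp only [h2]
  have h3 := ex_piWeight_one (a := fun (_ : Fin (dMin + dMax + 1)) x => p x)
    (fun _ => (coe_mem_stdSimplex p).2) (windowIndex d) fun x => if x₁ = x then 1 else 0
  refine h3.trans ?_
  simp [ex]

theorem ex_ratio₁_le (y : Y) : ex (fun x => p x) (fun x₁ => ratio₁ W p q d x₁ y) ≤ 1 := by
  have := sum_mul_mutRatio_le (p := fun x₁ y => ∑ v, ∑ x₂, jointLaw W p q d x₁ v x₂ y)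
    (fun _ _ => Finset.sum_nonneg fun _ _ => Finset.sum_nonneg fun _ _ =>
      jointLaw_nonneg W p q d _ _ _ _) y
  simp only [sum_law_X₁] at this
  exact this

theorem ex_logb_ratio₂ :
    ex (piWeight fun _ x => p x) (fun v => ex (pairLaw W q d v) fun z =>
      Real.logb 2 (ratio₂ W p q d v z.1 z.2)) = infoX₂YgivenV W p q d := by
  change _ = ∑ v, ∑ x₂, ∑ y, (∑ x₁, jointLaw W p q d x₁ v x₂ y) *
    Real.logb 2 (ratio₂ W p q d v x₂ y)
  simp only [sum_jointLaw, ex, Fintype.sum_prod_type, Finset.mul_sum, mul_assoc]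

theorem ex_logb_ratio₁ :
    ex (piWeight fun _ x => p x) (fun v => ex (pairLaw W q d v) fun z =>
      Real.logb 2 (ratio₁ W p q d (v (windowIndex d)) z.2)) = infoX₁Y W p q d := by
  classical
  change _ = ∑ x₁, ∑ y, (∑ v, ∑ x₂, jointLaw W p q d x₁ v x₂ y) *
    Real.logb 2 (ratio₁ W p q d x₁ y)
  have h1 : ∀ x₁, ∑ y, (∑ v, ∑ x₂, jointLaw W p q d x₁ v x₂ y) *
      Real.logb 2 (ratio₁ W p q d x₁ y) = ∑ v, ∑ x₂, ∑ y, jointLaw W p q d x₁ v x₂ y *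
      Real.logb 2 (ratio₁ W p q d x₁ y) := by
    intro x₁
    simp only [Finset.sum_mul]
    rw [Finset.sum_comm]
    exact Finset.sum_congr rfl fun v _ => Finset.sum_comm
  simp only [h1]
  rw [Finset.sum_comm]
  refine Finset.sum_congr rfl fun v _ => ?_
  rw [Finset.sum_eq_single (v (windowIndex d))]
  · simp only [jointLaw, piWeight, pairLaw, ex, Fintype.sum_prod_type, Finset.mul_sum, if_true,
      mul_one, mul_assoc]
  · intro b _ hb
    simp [jointLaw, hb]
  · simp

end Scores

/-! ### Random coding with windows -/

section WindowCoding

/-- Merges second codeword and output into one sequence of independent pairs, the form in which the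
weak law is applied. -/
theorem ex_piWeight_pair {K A B : Type*} [Fintype K] [Fintype A] [Fintype B] [DecidableEq K]
    (q : K → A → ℝ) (w : K → A → B → ℝ) (F : (K → A) → (K → B) → ℝ) :
    ex (piWeight q) (fun b => ex (piWeight fun k => w k (b k)) fun o => F b o) =
      ex (piWeight fun k (c : A × B) => q k c.1 * w k c.1 c.2)
        fun z => F (fun k => (z k).1) (fun k => (z k).2) := by
  simp only [ex, Finset.mul_sum]
  rw [← Fintype.sum_prod_type']
  refine (Fintype.sum_equiv (Equiv.arrowProdEquivProdArrow K (fun _ => A) fun _ => B) _ _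
    fun z => ?_).symm
  simp only [piWeight, Equiv.arrowProdEquivProdArrow, Equiv.coe_fn_mk, Finset.prod_mul_distrib,
    mul_assoc]

/-- Pointwise form of Markov's inequality. -/
theorem ind_rpow_le (t x : ℝ) (hx : 0 ≤ x) : ind ((2 : ℝ) ^ t ≤ x) ≤ (2 : ℝ) ^ (-t) * x := by
  have h2 : (0 : ℝ) < (2 : ℝ) ^ (-t) := Real.rpow_pos_of_pos two_pos _
  by_cases h : (2 : ℝ) ^ t ≤ x
  · rw [ind_true h]
    calc (1 : ℝ) = (2 : ℝ) ^ (-t) * (2 : ℝ) ^ t := by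
          rw [← Real.rpow_add two_pos, neg_add_cancel, Real.rpow_zero]
      _ ≤ _ := mul_le_mul_of_nonneg_left h h2.le
  · rw [ind_false h]
    positivity

theorem ind_not_rpow_le_prod {K : Type*} [Fintype K] {ρ : K → ℝ} (hρ : ∀ k, 0 < ρ k) (t : ℝ) :
    ¬((2 : ℝ) ^ t ≤ ∏ k, ρ k) → ∑ k, Real.logb 2 (ρ k) < t := by
  intro h
  rw [not_le] at h
  rw [← Real.logb_prod _ _ fun k _ => (hρ k).ne']
  exact (Real.logb_lt_iff_lt_rpow one_lt_two (Finset.prod_pos fun k _ => hρ k)).2 h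

variable {X₁ X₂ Y : Type*} [Fintype X₁] [Fintype X₂] [Fintype Y]
  {J K L : Type*} [Fintype K] [DecidableEq K]
  (W : X₁ → X₂ → stdSimplex ℝ Y) {dMin dMax : ℕ}
  (p : L → stdSimplex ℝ X₁) (q : L → Window X₁ dMin dMax → stdSimplex ℝ X₂)
  (e : K → Fin (dMin + dMax + 1) → J) (lab : K → L)

/-- The law of the outputs for the codewords `a` and `b`. -/
def outLaw (d : Delay dMin dMax) (a : J → X₁) (b : K → X₂) : (K → Y) → ℝ :=
  piWeight fun k y => W (a (e k (windowIndex d))) (b k) y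

/-- The law of the second codeword given the first. -/
def encLaw (a : J → X₁) : (K → X₂) → ℝ := piWeight fun k x₂ => q (lab k) (a ∘ e k) x₂

/-- The threshold test for the delay `d`. -/
def windowTest (t₂ t : ℝ) (d : Delay dMin dMax) (a : J → X₁) (b : K → X₂) (o : K → Y) : Prop :=
  (2 : ℝ) ^ t₂ ≤ ∏ k, ratio₂ W (p (lab k)) (q (lab k)) d (a ∘ e k) (b k) (o k) ∧
  (2 : ℝ) ^ t ≤ ∏ k, (ratio₁ W (p (lab k)) (q (lab k)) d (a (e k (windowIndex d))) (o k) *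
    ratio₂ W (p (lab k)) (q (lab k)) d (a ∘ e k) (b k) (o k))

/-- Given `a`, the symbols of `b` are independent even though the windows overlap, so the mean of
the product factors. -/
theorem ex_encLaw_prod_ratio₂_le (d : Delay dMin dMax) (a : J → X₁) (o : K → Y) :
    ex (encLaw q e lab a) (fun b =>
      ∏ k, ratio₂ W (p (lab k)) (q (lab k)) d (a ∘ e k) (b k) (o k)) ≤ 1 := by
  have := ex_piWeight_prod (fun k x₂ => q (lab k) (a ∘ e k) x₂)
    fun k x₂ => ratio₂ W (p (lab k)) (q (lab k)) d (a ∘ e k) x₂ (o k)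
  refine this.trans_le (Finset.prod_le_one (fun k _ => ?_) fun k _ => ex_ratio₂_le W _ _ d _ _)
  exact ex_nonneg (fun _ => (q _ _).2.1 _) fun _ => ratio₂_nonneg W _ _ _ _ _ _

omit [Fintype X₁] in
theorem encLaw_mem (a : J → X₁) : encLaw q e lab a ∈ stdSimplex ℝ (K → X₂) :=
  piWeight_mem_stdSimplex fun _ => coe_mem_stdSimplex _

omit [Fintype X₁] [Fintype X₂] in
theorem outLaw_mem (d : Delay dMin dMax) (a : J → X₁) (b : K → X₂) :
    outLaw W e d a b ∈ stdSimplex ℝ (K → Y) :=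
  piWeight_mem_stdSimplex fun _ => coe_mem_stdSimplex _

theorem ex_encLaw_windowTest_le (t₂ t : ℝ) (d : Delay dMin dMax) (a : J → X₁) (o : K → Y) :
    ex (encLaw q e lab a) (fun b => ind (windowTest W p q e lab t₂ t d a b o)) ≤
      (2 : ℝ) ^ (-t₂) := by
  have h : ∀ b : K → X₂, ind (windowTest W p q e lab t₂ t d a b o) ≤ (2 : ℝ) ^ (-t₂) *
      ∏ k, ratio₂ W (p (lab k)) (q (lab k)) d (a ∘ e k) (b k) (o k) := by
    intro b
    have h0 : 0 ≤ ∏ k, ratio₂ W (p (lab k)) (q (lab k)) d (a ∘ e k) (b k) (o k) :=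
      Finset.prod_nonneg fun k _ => ratio₂_nonneg W _ _ _ _ _ _
    by_cases hT : windowTest W p q e lab t₂ t d a b o
    · rw [ind_true hT, ← ind_true hT.1]
      exact ind_rpow_le _ _ h0
    · rw [ind_false hT]
      positivity
  refine (ex_mono (encLaw_mem q e lab a).1 h).trans ?_
  rw [ex_const_mul]
  exact mul_le_of_le_one_right (Real.rpow_nonneg two_pos.le _)
    (ex_encLaw_prod_ratio₂_le W p q e lab d a o)

variable [Fintype J] [DecidableEq J] (blk : J → L)

/-- Overlapping windows make the `ratio₂` factors dependent through `a`. Averaging over `b` first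
bounds their product by 1, and the remaining factors `ratio₁` each read a single symbol of `a`. By
`he'` these symbols sit at distinct positions, so the mean factors. -/
theorem ex_ex_windowTest_le (hlab : ∀ k i, blk (e k i) = lab k)
    (he' : ∀ i, Function.Injective fun k => e k i) (t₂ t : ℝ) (d : Delay dMin dMax)
    (o : K → Y) :
    ex (piWeight fun j x => p (blk j) x) (fun a => ex (encLaw q e lab a)
      fun b => ind (windowTest W p q e lab t₂ t d a b o)) ≤ (2 : ℝ) ^ (-t) := by
  have hP : piWeight (fun j x => p (blk j) x) ∈ stdSimplex ℝ (J → X₁) :=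
    piWeight_mem_stdSimplex fun _ => coe_mem_stdSimplex _
  have h : ∀ (a : J → X₁) (b : K → X₂), ind (windowTest W p q e lab t₂ t d a b o) ≤
      (2 : ℝ) ^ (-t) * ((∏ k, ratio₁ W (p (lab k)) (q (lab k)) d (a (e k (windowIndex d))) (o k)) *
      ∏ k, ratio₂ W (p (lab k)) (q (lab k)) d (a ∘ e k) (b k) (o k)) := by
    intro a b
    rw [← Finset.prod_mul_distrib]
    have h0 : 0 ≤ ∏ k, (ratio₁ W (p (lab k)) (q (lab k)) d (a (e k (windowIndex d))) (o k) *
        ratio₂ W (p (lab k)) (q (lab k)) d (a ∘ e k) (b k) (o k)) :=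
      Finset.prod_nonneg fun k _ =>
        mul_nonneg (ratio₁_nonneg W _ _ _ _ _) (ratio₂_nonneg W _ _ _ _ _ _)
    by_cases hT : windowTest W p q e lab t₂ t d a b o
    · rw [ind_true hT, ← ind_true hT.2]
      exact ind_rpow_le _ _ h0
    · rw [ind_false hT]
      positivity
  have h1 : ∀ a : J → X₁, ex (encLaw q e lab a)
      (fun b => ind (windowTest W p q e lab t₂ t d a b o)) ≤ (2 : ℝ) ^ (-t) *
      ∏ k, ratio₁ W (p (lab k)) (q (lab k)) d (a (e k (windowIndex d))) (o k) := by
    intro a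
    refine (ex_mono (encLaw_mem q e lab a).1 (h a)).trans ?_
    rw [ex_const_mul, ex_const_mul]
    refine mul_le_mul_of_nonneg_left ?_ (Real.rpow_nonneg two_pos.le _)
    exact mul_le_of_le_one_right (Finset.prod_nonneg fun k _ => ratio₁_nonneg W _ _ _ _ _)
      (ex_encLaw_prod_ratio₂_le W p q e lab d a o)
  refine (ex_mono hP.1 h1).trans ?_
  rw [ex_const_mul]
  refine mul_le_of_le_one_right (Real.rpow_nonneg two_pos.le _) ?_
  have h2 := ex_piWeight_comp (a := fun j x => p (blk j) x)
    (fun j => (coe_mem_stdSimplex (p (blk j))).2) (he' (windowIndex d))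
    fun u => ∏ k, ratio₁ W (p (lab k)) (q (lab k)) d (u k) (o k)
  refine h2.trans_le ?_
  rw [ex_piWeight_prod (fun k x => p (blk (e k (windowIndex d))) x)
    fun k x => ratio₁ W (p (lab k)) (q (lab k)) d x (o k)]
  refine Finset.prod_le_one (fun k _ => ?_) fun k _ => ?_
  · exact ex_nonneg (fun _ => (p _).2.1 _) fun _ => ratio₁_nonneg W _ _ _ _ _
  · rw [hlab]
    exact ex_ratio₁_le W _ _ d _

/-- The sum of the two information densities at one time. -/
def sumDensity (p : stdSimplex ℝ X₁) (q : Window X₁ dMin dMax → stdSimplex ℝ X₂)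
    (d : Delay dMin dMax) (v : Window X₁ dMin dMax) (z : X₂ × Y) : ℝ :=
  Real.logb 2 (ratio₁ W p q d (v (windowIndex d)) z.2) + Real.logb 2 (ratio₂ W p q d v z.1 z.2)

theorem ex_sumDensity (p : stdSimplex ℝ X₁) (q : Window X₁ dMin dMax → stdSimplex ℝ X₂)
    (d : Delay dMin dMax) :
    ex (piWeight fun _ x => p x) (fun v => ex (pairLaw W q d v) (sumDensity W p q d v)) =
      infoX₁Y W p q d + infoX₂YgivenV W p q d := by
  unfold sumDensity
  simp only [ex_add]
  rw [ex_logb_ratio₁, ex_logb_ratio₂]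

/-- Where the probability is positive, a failed threshold means that one of two sums of information
densities falls below its mean by at least `s`; the factor 2 counts these events. Null points are
discarded first, since `logb 2 0 = 0` would break the link between products and sums. -/
theorem ex_not_windowTest_le (hlab : ∀ k i, blk (e k i) = lab k)
    (he : ∀ k, Function.Injective (e k)) {C : ℕ}
    (hC : ∀ k, {k' | ¬∀ i i', e k i ≠ e k' i'}.ncard ≤ C) (d : Delay dMin dMax) {B : ℝ}
    (hB₂ : ∀ l v (z : X₂ × Y), |Real.logb 2 (ratio₂ W (p l) (q l) d v z.1 z.2) -
      infoX₂YgivenV W (p l) (q l) d| ≤ B)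
    (hB : ∀ l v z, |sumDensity W (p l) (q l) d v z -
      (infoX₁Y W (p l) (q l) d + infoX₂YgivenV W (p l) (q l) d)| ≤ B)
    {t₂ t s : ℝ} (hs : 0 < s) (ht₂ : t₂ + s ≤ ∑ k, infoX₂YgivenV W (p (lab k)) (q (lab k)) d)
    (ht : t + s ≤ ∑ k, (infoX₁Y W (p (lab k)) (q (lab k)) d +
      infoX₂YgivenV W (p (lab k)) (q (lab k)) d)) :
    ex (piWeight fun j x => p (blk j) x) (fun a => ex (encLaw q e lab a) fun b =>
      ex (outLaw W e d a b) fun o => ind (¬windowTest W p q e lab t₂ t d a b o)) ≤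
      2 * (Fintype.card K * (C * B ^ 2) / s ^ 2) := by
  have hp : ∀ j, (fun x => p (blk j) x) ∈ stdSimplex ℝ X₁ := fun j => coe_mem_stdSimplex _
  have hP : piWeight (fun j x => p (blk j) x) ∈ stdSimplex ℝ (J → X₁) :=
    piWeight_mem_stdSimplex hp
  have hr : ∀ k (v : Window X₁ dMin dMax), pairLaw W (q (lab k)) d v ∈ stdSimplex ℝ (X₂ × Y) :=
    fun k v => pairLaw_mem W (q (lab k)) d v
  have h₂ := ex_windows_lt_le hp he hr
    (fun k v z => Real.logb 2 (ratio₂ W (p (lab k)) (q (lab k)) d v z.1 z.2))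
    (fun k => by simp only [hlab]; exact ex_logb_ratio₂ W (p (lab k)) (q (lab k)) d)
    (fun k v z => hB₂ (lab k) v z) hC hs ht₂
  have h₁ := ex_windows_lt_le hp he hr
    (fun k v z => sumDensity W (p (lab k)) (q (lab k)) d v z)
    (fun k => by simp only [hlab]; exact ex_sumDensity W (p (lab k)) (q (lab k)) d)
    (fun k v z => hB (lab k) v z) hC hs ht
  rw [two_mul]
  refine le_trans ?_ (add_le_add h₂ h₁)
  simp only [← ex_add]
  refine ex_mono_of_pos hP.1 fun a ha => ?_
  have hpair := ex_piWeight_pair (fun k x₂ => q (lab k) (a ∘ e k) x₂)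
    (fun k x₂ y => W (a (e k (windowIndex d))) x₂ y)
    fun b o => ind (¬windowTest W p q e lab t₂ t d a b o)
  refine hpair.trans_le ?_
  refine ex_mono_of_pos (piWeight_mem_stdSimplex fun k => hr k (a ∘ e k)).1 fun z hz => ?_
  have hv : ∀ k, 0 < piWeight (fun _ x => p (lab k) x) (a ∘ e k) := fun k => by
    refine Finset.prod_pos fun i _ => ?_
    have := pos_of_piWeight_pos (a := fun j x => p (blk j) x) (fun j s => (hp j).1 s) ha (e k i)
    rwa [hlab] at this
  have hz' : ∀ k, 0 < pairLaw W (q (lab k)) d (a ∘ e k) (z k) :=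
    pos_of_piWeight_pos (a := fun k => pairLaw W (q (lab k)) d (a ∘ e k))
      (fun k s => (hr k (a ∘ e k)).1 s) hz
  have hρ₁ : ∀ k, 0 < ratio₁ W (p (lab k)) (q (lab k)) d (a (e k (windowIndex d))) (z k).2 :=
    fun k => ratio₁_pos W (p (lab k)) (q (lab k)) d (v := a ∘ e k) (x₂ := (z k).1) (y := (z k).2)
      (hv k) (hz' k)
  have hρ₂ : ∀ k, 0 < ratio₂ W (p (lab k)) (q (lab k)) d (a ∘ e k) (z k).1 (z k).2 :=
    fun k => ratio₂_pos W (p (lab k)) (q (lab k)) d (v := a ∘ e k) (x₂ := (z k).1) (y := (z k).2)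
      (hv k) (hz' k)
  by_cases hT : windowTest W p q e lab t₂ t d a (fun k => (z k).1) fun k => (z k).2
  · rw [ind_false (not_not.2 hT)]
    exact add_nonneg (ind_nonneg _) (ind_nonneg _)
  · rw [ind_true hT]
    rcases not_and_or.1 hT with h | h
    · have := ind_not_rpow_le_prod hρ₂ _ h
      rw [ind_true this]
      linarith [ind_nonneg (∑ k, sumDensity W (p (lab k)) (q (lab k)) d (a ∘ e k) (z k) < t)]
    · have := ind_not_rpow_le_prod (fun k => mul_pos (hρ₁ k) (hρ₂ k)) _ h
      have h' : ∑ k, sumDensity W (p (lab k)) (q (lab k)) d (a ∘ e k) (z k) < t := by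
        refine lt_of_eq_of_lt (Finset.sum_congr rfl fun k _ => ?_) this
        exact (Real.logb_mul (hρ₁ k).ne' (hρ₂ k).ne').symm
      rw [ind_true h']
      linarith [ind_nonneg (∑ k, Real.logb 2 (ratio₂ W (p (lab k)) (q (lab k)) d (a ∘ e k)
        (z k).1 (z k).2) < t₂)]

/-- Random coding for the outputs whose windows lie within one block of the labelling. -/
theorem exists_window_code (hlab : ∀ k i, blk (e k i) = lab k)
    (he : ∀ k, Function.Injective (e k)) (he' : ∀ i, Function.Injective fun k => e k i) {C : ℕ}
    (hC : ∀ k, {k' | ¬∀ i i', e k i ≠ e k' i'}.ncard ≤ C) {B : ℝ}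
    (hB₂ : ∀ d l v (z : X₂ × Y), |Real.logb 2 (ratio₂ W (p l) (q l) d v z.1 z.2) -
      infoX₂YgivenV W (p l) (q l) d| ≤ B)
    (hB : ∀ d l v z, |sumDensity W (p l) (q l) d v z -
      (infoX₁Y W (p l) (q l) d + infoX₂YgivenV W (p l) (q l) d)| ≤ B)
    {t₂ t s : ℝ} (hs : 0 < s)
    (ht₂ : ∀ d, t₂ + s ≤ ∑ k, infoX₂YgivenV W (p (lab k)) (q (lab k)) d)
    (ht : ∀ d, t + s ≤ ∑ k, (infoX₁Y W (p (lab k)) (q (lab k)) d +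
      infoX₂YgivenV W (p (lab k)) (q (lab k)) d))
    {M₁ M₂ : ℕ} (hM₁ : 0 < M₁) (hM₂ : 0 < M₂) :
    ∃ (x₁ : Fin M₁ → J → X₁) (x₂ : Fin M₁ → Fin M₂ → K → X₂)
      (dec : (K → Y) → Fin M₁ × Fin M₂), ∀ d,
      1 / ((M₁ : ℝ) * M₂) * ∑ m₁, ∑ m₂,
        ex (outLaw W e d (x₁ m₁) (x₂ m₁ m₂)) (fun o => ind (dec o ≠ (m₁, m₂))) ≤
      (Fintype.card (Delay dMin dMax) : ℝ) * (2 * (Fintype.card K * (C * B ^ 2) / s ^ 2) +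
        (Fintype.card (Delay dMin dMax) : ℝ) *
        (((M₂ : ℝ) - 1) * (2 : ℝ) ^ (-t₂) + ((M₁ : ℝ) - 1) * M₂ * (2 : ℝ) ^ (-t))) :=
  exists_code_of_tests (piWeight_mem_stdSimplex fun j => coe_mem_stdSimplex (p (blk j)))
    (encLaw_mem q e lab) (outLaw_mem W e) (windowTest W p q e lab t₂ t)
    (fun d => ex_not_windowTest_le W p q e lab blk hlab he hC d (hB₂ d) (hB d) hs (ht₂ d) (ht d))
    (ex_encLaw_windowTest_le W p q e lab t₂ t)
    (ex_ex_windowTest_le W p q e lab blk hlab he' t₂ t) hM₁ hM₂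

end WindowCoding

/-! ### From windows to codes for the asynchronous channel -/

section Blocks

/-- The segments are laid end to end by `finSigmaFinEquiv`; the times left over after the last one
get an arbitrary label. -/
theorem exists_blocks_fin {m : ℕ} [Nonempty (Fin m)] (n : ℕ) (len : Fin m → ℕ)
    (hlen : ∑ l, len l ≤ n) :
    ∃ (blk : Fin n → Fin m) (start : Fin m → ℕ), ∀ l j, start l ≤ j → j < start l + len l →
      ∃ h : j < n, blk ⟨j, h⟩ = l := by
  refine ⟨fun i => if h : (i : ℕ) < ∑ l, len l then (finSigmaFinEquiv.symm ⟨i, h⟩).1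
    else Classical.arbitrary _, fun l => ∑ i : Fin l, len (Fin.castLE l.2.le i), ?_⟩
  intro l j h1 h2
  obtain ⟨r, rfl⟩ := Nat.exists_eq_add_of_le h1
  have hr : r < len l := by omega
  have hval := finSigmaFinEquiv_apply (n := len) ⟨l, ⟨r, hr⟩⟩
  have hlt := (finSigmaFinEquiv (n := len) ⟨l, ⟨r, hr⟩⟩).2
  simp only at hval
  rw [hval] at hlt
  refine ⟨hlt.trans_le hlen, ?_⟩
  simp only
  rw [dif_pos hlt]
  have : (⟨_, hlt⟩ : Fin (∑ l, len l)) = finSigmaFinEquiv ⟨l, ⟨r, hr⟩⟩ := Fin.ext hval.symm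
  rw [this, Equiv.symm_apply_apply]

/-- The times `0, …, n - 1` can be divided into consecutive blocks with lengths proportional to
given weights, up to rounding. -/
theorem exists_blocks {L : Type*} [Fintype L] {w : L → ℝ} (hw : ∀ l, 0 ≤ w l)
    (hw1 : ∑ l, w l = 1) (n : ℕ) :
    ∃ (blk : Fin n → L) (start len : L → ℕ), (∀ l, w l * n - 1 ≤ len l) ∧
      ∀ l j, start l ≤ j → j < start l + len l → ∃ h : j < n, blk ⟨j, h⟩ = l := by
  have hne : Nonempty L := by
    by_contra h
    rw [not_nonempty_iff] at h
    simp at hw1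
  let φ := Fintype.equivFin L
  have : Nonempty (Fin (Fintype.card L)) := hne.map φ
  have hlen : ∑ i, ⌊w (φ.symm i) * n⌋₊ ≤ n := by
    rw [Equiv.sum_comp φ.symm fun l => ⌊w l * n⌋₊]
    have : ((∑ l, ⌊w l * n⌋₊ : ℕ) : ℝ) ≤ n := by
      push_cast
      calc ∑ l, ((⌊w l * n⌋₊ : ℕ) : ℝ) ≤ ∑ l, w l * n :=
            Finset.sum_le_sum fun l _ => Nat.floor_le (mul_nonneg (hw l) n.cast_nonneg)
        _ = n := by rw [← Finset.sum_mul, hw1, one_mul]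
    exact_mod_cast this
  obtain ⟨blk, start, h⟩ := exists_blocks_fin n (fun i => ⌊w (φ.symm i) * n⌋₊) hlen
  refine ⟨fun i => φ.symm (blk i), fun l => start (φ l), fun l => ⌊w l * n⌋₊,
    fun l => (Nat.sub_one_lt_floor _).le, fun l j h1 h2 => ?_⟩
  obtain ⟨hj, hb⟩ := h (φ l) j h1 (by simpa using h2)
  exact ⟨hj, by simp only; rw [hb, Equiv.symm_apply_apply]⟩

end Blocks

/-! ### Times whose window stays inside one segment -/

section Interior

variable {L : Type*} {n : ℕ} (dMin dMax : ℕ) (blk : Fin n → L)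

/-- The times whose windows lie within one block. -/
abbrev Interior : Type :=
  {i : Fin n // dMax ≤ (i : ℕ) ∧ (i : ℕ) + dMin < n ∧
    ∀ j : Fin n, (i : ℕ) ≤ j + dMax → (j : ℕ) ≤ i + dMin → blk j = blk i}

variable {dMin dMax blk}

/-- The positions in the window at a given time. -/
def windowPos (k : Interior dMin dMax blk) (i : Fin (dMin + dMax + 1)) : Fin n :=
  ⟨(k.1 : ℕ) - dMax + i, by have := k.2.1; have := k.2.2.1; omega⟩

theorem windowPos_val (k : Interior dMin dMax blk) (i : Fin (dMin + dMax + 1)) :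
    (windowPos k i : ℕ) + dMax = k.1 + i := by
  have := k.2.1
  simp only [windowPos]
  omega

theorem blk_windowPos (k : Interior dMin dMax blk) (i : Fin (dMin + dMax + 1)) :
    blk (windowPos k i) = blk k.1 := by
  have := windowPos_val k i
  exact k.2.2.2 _ (by omega) (by omega)

theorem windowPos_injective (k : Interior dMin dMax blk) : Function.Injective (windowPos k) := by
  intro i i' h
  have h1 := windowPos_val k i
  have h2 := windowPos_val k i'
  rw [h] at h1
  exact Fin.ext (by omega)

theorem windowPos_injective_left (i : Fin (dMin + dMax + 1)) :
    Function.Injective fun k : Interior dMin dMax blk => windowPos k i := by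
  intro k k' h
  have h1 := windowPos_val k i
  have h2 := windowPos_val k' i
  simp only at h
  rw [h] at h1
  exact Subtype.ext (Fin.ext (by omega))

/-- Two windows that meet have times at most `dMin + dMax` apart. -/
theorem ncard_overlap_le (k : Interior dMin dMax blk) :
    {k' : Interior dMin dMax blk | ¬∀ i i', windowPos k i ≠ windowPos k' i'}.ncard ≤
      2 * (dMin + dMax) + 1 := by
  set D := dMin + dMax
  have h : {k' : Interior dMin dMax blk | ¬∀ i i', windowPos k i ≠ windowPos k' i'}.ncard ≤
      (↑(Finset.Icc ((k.1 : ℕ) - D) (k.1 + D)) : Set ℕ).ncard := by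
    refine Set.ncard_le_ncard_of_injOn (fun k' => ((k'.1 : Fin n) : ℕ)) ?_ ?_
      (Finset.finite_toSet _)
    · intro k' hk'
      simp only [Set.mem_ofPred_eq, not_forall, not_not] at hk'
      obtain ⟨i, i', hii⟩ := hk'
      have h1 := windowPos_val k i
      have h2 := windowPos_val k' i'
      rw [hii] at h1
      have := i.2
      have := i'.2
      simp only [Finset.coe_Icc, Set.mem_Icc]
      omega
    · intro a _ b _ hab
      exact Subtype.ext (Fin.ext hab)
  refine h.trans ?_
  rw [Set.ncard_coe_finset, Nat.card_Icc]
  omega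

/-- Only the first `dMax` and the last `dMin` times of a segment can have windows that leave it. -/
theorem le_card_interior_label [DecidableEq L] {start len : L → ℕ}
    (h : ∀ l j, start l ≤ j → j < start l + len l → ∃ h : j < n, blk ⟨j, h⟩ = l) (l : L) :
    len l - (dMin + dMax) ≤
      (Finset.univ.filter fun k : Interior dMin dMax blk => blk k.1 = l).card := by
  classical
  have hlt : ∀ i : Fin (len l - (dMin + dMax)), start l + dMax + i < n := fun i =>
    (h l _ (by omega) (by omega)).1
  have hmem : ∀ i : Fin (len l - (dMin + dMax)), blk ⟨start l + dMax + i, hlt i⟩ = l := fun i =>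
    (h l _ (by omega) (by omega)).2
  let f : Fin (len l - (dMin + dMax)) → Interior dMin dMax blk := fun i =>
    ⟨⟨start l + dMax + i, hlt i⟩, by simp only; omega,
      (h l (start l + dMax + i + dMin) (by omega) (by omega)).1, fun j h1 h2 => by
        rw [hmem]
        simp only at h1 h2
        exact (h l j (by omega) (by omega)).2⟩
  have hf : Function.Injective f := by
    intro i i' hii
    have : start l + dMax + (i : ℕ) = start l + dMax + i' :=
      congrArg (fun k : Interior dMin dMax blk => ((k.1 : Fin n) : ℕ)) hii
    exact Fin.ext (by omega)
  have := Finset.card_le_card_of_injOn (s := Finset.univ)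
    (t := Finset.univ.filter fun k : Interior dMin dMax blk => blk k.1 = l) f
    (fun i _ => by simpa using hmem i) hf.injOn
  simpa using this

/-- Each segment loses at most `dMin + dMax` times at its ends and one by rounding, so the total
loss does not grow with `n`. Leftover times only help, as `c` is nonnegative. -/
theorem le_sum_interior [Fintype L] [DecidableEq L] {start len : L → ℕ}
    (h : ∀ l j, start l ≤ j → j < start l + len l → ∃ h : j < n, blk ⟨j, h⟩ = l)
    {w : L → ℝ} (hlen : ∀ l, w l * n - 1 ≤ len l) {c I : L → ℝ} (hc : ∀ l, 0 ≤ c l)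
    (hcI : ∀ l, c l ≤ I l) :
    n * ∑ l, w l * c l - (dMin + dMax + 1) * ∑ l, c l ≤
      ∑ k : Interior dMin dMax blk, I (blk k.1) := by
  classical
  calc (n : ℝ) * ∑ l, w l * c l - (dMin + dMax + 1) * ∑ l, c l
      = ∑ l, (w l * n - 1 - (dMin + dMax)) * c l := by
        rw [Finset.mul_sum, Finset.mul_sum, ← Finset.sum_sub_distrib]
        exact Finset.sum_congr rfl fun l _ => by ring
    _ ≤ ∑ l, ((Finset.univ.filter fun k : Interior dMin dMax blk => blk k.1 = l).card : ℝ) *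
        c l := by
        refine Finset.sum_le_sum fun l _ => mul_le_mul_of_nonneg_right ?_ (hc l)
        have h1 := le_card_interior_label (dMin := dMin) (dMax := dMax) h l
        have h2 : len l ≤ (Finset.univ.filter fun k : Interior dMin dMax blk =>
          blk k.1 = l).card + (dMin + dMax) := by omega
        have h3 : (len l : ℝ) ≤ ((Finset.univ.filter fun k : Interior dMin dMax blk =>
          blk k.1 = l).card : ℝ) + (dMin + dMax) := by exact_mod_cast h2
        linarith [hlen l]
    _ = ∑ l, ∑ k : Interior dMin dMax blk with blk k.1 = l, c (blk k.1) := by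
        refine Finset.sum_congr rfl fun l _ => ?_
        rw [Finset.sum_congr rfl fun k hk => by rw [(Finset.mem_filter.1 hk).2],
          Finset.sum_const, nsmul_eq_mul]
    _ = ∑ k : Interior dMin dMax blk, c (blk k.1) :=
        Finset.sum_fiberwise _ _ _
    _ ≤ _ := Finset.sum_le_sum fun k _ => hcI _

end Interior

/-! ### Discarding the times that arbitrary symbols can affect -/

section Reduction

variable {X₁ X₂ Y : Type*} [Fintype Y] (W : X₁ → X₂ → stdSimplex ℝ Y)
  {L : Type*} {n : ℕ} {dMin dMax : ℕ} {blk : Fin n → L}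

/-- At an interior time the delayed position is in the block for every delay, so `w` is never read.
-/
theorem extend_windowPos (x : Fin n → X₁) (w : ℤ → X₁) (d : Delay dMin dMax)
    (k : Interior dMin dMax blk) :
    extend x w (((k.1 : Fin n) : ℤ) - d.1) = x (windowPos k (windowIndex d)) := by
  have hd := Finset.mem_Icc.mp d.2
  have h1 := windowPos_val k (windowIndex d)
  have h2 := (windowPos k (windowIndex d)).2
  have h3 : ((windowIndex d : Fin (dMin + dMax + 1)) : ℕ) = ((dMax : ℤ) - d.1).toNat := rfl
  unfold extend
  rw [dif_pos ⟨by omega, by omega⟩]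
  congr 1
  exact Fin.ext (by simp only; omega)

open Classical in
/-- The code for the asynchronous channel whose decoder only uses the interior times. -/
def interiorCode (x₂₀ : X₂) {M₁ M₂ : ℕ} (x₁ : Fin M₁ → Fin n → X₁)
    (x₂ : Fin M₁ → Fin M₂ → Interior dMin dMax blk → X₂)
    (dec : (Interior dMin dMax blk → Y) → Fin M₁ × Fin M₂) : Code X₁ X₂ Y M₁ M₂ n where
  enc₁ := x₁
  enc₂ m₁ m₂ i := if h : _ then x₂ m₁ m₂ ⟨i, h⟩ else x₂₀
  dec y := dec fun k => y k.1

/-- The symbols outside of the block do not influence the error probability. -/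
theorem avgError_interiorCode [DecidableEq L] [Fintype X₁] [Fintype X₂] (x₂₀ : X₂) {M₁ M₂ : ℕ}
    (x₁ : Fin M₁ → Fin n → X₁)
    (x₂ : Fin M₁ → Fin M₂ → Interior dMin dMax blk → X₂)
    (dec : (Interior dMin dMax blk → Y) → Fin M₁ × Fin M₂) (d : Delay dMin dMax)
    (w : Fin M₁ → Fin M₂ → ℤ → X₁) :
    avgError W (interiorCode x₂₀ x₁ x₂ dec) d.1 w = 1 / ((M₁ : ℝ) * M₂) * ∑ m₁, ∑ m₂,
        ex (outLaw W windowPos d (x₁ m₁) (x₂ m₁ m₂)) (fun o => ind (dec o ≠ (m₁, m₂))) := by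
  classical
  unfold avgError
  congr 1
  refine Finset.sum_congr rfl fun m₁ _ => Finset.sum_congr rfl fun m₂ _ => ?_
  set c := interiorCode x₂₀ x₁ x₂ dec
  set a : Fin n → Y → ℝ := fun i y =>
    W (extend (x₁ m₁) (w m₁ m₂) ((i : ℤ) - d.1)) (c.enc₂ m₁ m₂ i) y
  have h1 : ∑ y : Fin n → Y with c.dec y ≠ (m₁, m₂),
      transProb W d.1 (w m₁ m₂) (c.enc₁ m₁) (c.enc₂ m₁ m₂) y =
      ex (piWeight a) fun y => ind (dec (y ∘ Subtype.val) ≠ (m₁, m₂)) := by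
    rw [Finset.sum_filter, ex]
    refine Finset.sum_congr rfl fun y _ => ?_
    have hy : c.dec y = dec (y ∘ Subtype.val) := rfl
    rw [hy]
    unfold ind
    split_ifs
    · rw [mul_one]
      rfl
    · rw [mul_zero]
  -- The outputs at the other times, the only ones that `w` can affect, are summed out.
  rw [h1, ex_piWeight_comp (fun i => (coe_mem_stdSimplex (W _ _)).2) Subtype.val_injective
    fun o => ind (dec o ≠ (m₁, m₂))]
  congr 1
  unfold outLaw
  congr 1
  funext k y
  have h2 : c.enc₂ m₁ m₂ k.1 = x₂ m₁ m₂ k := by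
    simp only [c, interiorCode]
    rw [dif_pos k.2]
  simp only [h2, extend_windowPos]

end Reduction

/-! ### Achievability of the inner region -/

section Achievability

theorem ceil_rpow_pos (x : ℝ) : 0 < ⌈(2 : ℝ) ^ x⌉₊ :=
  Nat.ceil_pos.2 (Real.rpow_pos_of_pos two_pos _)

/-- Covers the short block lengths, for which any code will do. -/
theorem avgError_le_one {X₁ X₂ Y : Type*} [Fintype Y] (W : X₁ → X₂ → stdSimplex ℝ Y)
    {M₁ M₂ n : ℕ} (c : Code X₁ X₂ Y M₁ M₂ n) (d : ℤ) (w : Fin M₁ → Fin M₂ → ℤ → X₁) :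
    avgError W c d w ≤ 1 := by
  classical
  have h : ∀ m₁ m₂, ∑ y : Fin n → Y with c.dec y ≠ (m₁, m₂),
      transProb W d (w m₁ m₂) (c.enc₁ m₁) (c.enc₂ m₁ m₂) y ≤ 1 := by
    intro m₁ m₂
    have hmem : piWeight (fun (i : Fin n) y => W (extend (c.enc₁ m₁) (w m₁ m₂) ((i : ℤ) - d))
        (c.enc₂ m₁ m₂ i) y) ∈ stdSimplex ℝ (Fin n → Y) :=
      piWeight_mem_stdSimplex fun i => coe_mem_stdSimplex _
    refine (Finset.sum_le_sum_of_subset_of_nonneg (Finset.filter_subset _ _)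
      fun y _ _ => hmem.1 y).trans_eq hmem.2
  unfold avgError
  refine (mul_le_mul_of_nonneg_left (Finset.sum_le_sum fun m₁ _ =>
    Finset.sum_le_sum fun m₂ _ => h m₁ m₂) (by positivity)).trans ?_
  simp only [Finset.sum_const, Finset.card_univ, Fintype.card_fin, nsmul_eq_mul, mul_one]
  rw [one_div]
  exact inv_mul_le_one

/-- At rate zero there is one message and no competitor, so no slack is required. Otherwise the
exponent is at most `-δ` per symbol. -/
theorem ceil_rpow_sub_one_mul_le {r R δ : ℝ} (n : ℕ) (h : r ≠ 0 → r + 2 * δ ≤ R) :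
    ((⌈(2 : ℝ) ^ ((n : ℝ) * r)⌉₊ : ℝ) - 1) * (2 : ℝ) ^ (-((n : ℝ) * (R - δ))) ≤
      ((2 : ℝ) ^ (-δ)) ^ n := by
  rcases eq_or_ne r 0 with rfl | hr
  · simp
    positivity
  · have h1 : (⌈(2 : ℝ) ^ ((n : ℝ) * r)⌉₊ : ℝ) - 1 ≤ (2 : ℝ) ^ ((n : ℝ) * r) := by
      linarith [Nat.ceil_lt_add_one (Real.rpow_nonneg two_pos.le ((n : ℝ) * r))]
    refine (mul_le_mul_of_nonneg_right h1 (Real.rpow_nonneg two_pos.le _)).trans ?_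
    rw [← Real.rpow_add two_pos, ← Real.rpow_natCast, ← Real.rpow_mul two_pos.le]
    refine Real.rpow_le_rpow_of_exponent_le one_le_two ?_
    have := h hr
    nlinarith [n.cast_nonneg (α := ℝ)]

theorem ceil_rpow_sub_one_mul_mul_le {r₁ r₂ R δ : ℝ} (hr₂ : 0 ≤ r₂) (n : ℕ)
    (h : r₁ ≠ 0 → r₁ + r₂ + 2 * δ ≤ R) :
    ((⌈(2 : ℝ) ^ ((n : ℝ) * r₁)⌉₊ : ℝ) - 1) * ⌈(2 : ℝ) ^ ((n : ℝ) * r₂)⌉₊ *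
      (2 : ℝ) ^ (-((n : ℝ) * (R - δ))) ≤ 2 * ((2 : ℝ) ^ (-δ)) ^ n := by
  have h1 : (⌈(2 : ℝ) ^ ((n : ℝ) * r₂)⌉₊ : ℝ) ≤ 2 * (2 : ℝ) ^ ((n : ℝ) * r₂) := by
    have h2 : (1 : ℝ) ≤ (2 : ℝ) ^ ((n : ℝ) * r₂) :=
      Real.one_le_rpow one_le_two (mul_nonneg n.cast_nonneg hr₂)
    linarith [Nat.ceil_lt_add_one (Real.rpow_nonneg two_pos.le ((n : ℝ) * r₂))]
  have h3 := ceil_rpow_sub_one_mul_le (r := r₁) (R := R - r₂) (δ := δ) n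
    fun h0 => by linarith [h h0]
  have h4 : (0 : ℝ) ≤ (⌈(2 : ℝ) ^ ((n : ℝ) * r₁)⌉₊ : ℝ) - 1 :=
    sub_nonneg.2 (by exact_mod_cast ceil_rpow_pos _)
  calc _ ≤ ((⌈(2 : ℝ) ^ ((n : ℝ) * r₁)⌉₊ : ℝ) - 1) * (2 * (2 : ℝ) ^ ((n : ℝ) * r₂)) *
      (2 : ℝ) ^ (-((n : ℝ) * (R - δ))) := by gcongr
    _ = 2 * (((⌈(2 : ℝ) ^ ((n : ℝ) * r₁)⌉₊ : ℝ) - 1) *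
      ((2 : ℝ) ^ ((n : ℝ) * r₂) * (2 : ℝ) ^ (-((n : ℝ) * (R - δ))))) := by ring
    _ = 2 * (((⌈(2 : ℝ) ^ ((n : ℝ) * r₁)⌉₊ : ℝ) - 1) *
      (2 : ℝ) ^ (-((n : ℝ) * (R - r₂ - δ)))) := by
        rw [← Real.rpow_add two_pos]
        congr 3
        ring
    _ ≤ _ := by linarith

variable {X₁ X₂ Y : Type*} [Fintype X₁] [Fintype X₂] [Fintype Y]
  (W : X₁ → X₂ → stdSimplex ℝ Y) {dMin dMax : ℕ} {L : Type*} [Fintype L]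
  (p : L → stdSimplex ℝ X₁) (q : L → Window X₁ dMin dMax → stdSimplex ℝ X₂)

/-- Finitely many real values; null points are harmless because `logb 2 0 = 0`. -/
theorem exists_density_bound : ∃ B : ℝ,
    (∀ d l v (z : X₂ × Y), |Real.logb 2 (ratio₂ W (p l) (q l) d v z.1 z.2) -
      infoX₂YgivenV W (p l) (q l) d| ≤ B) ∧
    ∀ d l v z, |sumDensity W (p l) (q l) d v z -
      (infoX₁Y W (p l) (q l) d + infoX₂YgivenV W (p l) (q l) d)| ≤ B := by
  obtain ⟨B₁, h₁⟩ := (Set.finite_range fun i : Delay dMin dMax × L × Window X₁ dMin dMax ×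
    (X₂ × Y) => |Real.logb 2 (ratio₂ W (p i.2.1) (q i.2.1) i.1 i.2.2.1 i.2.2.2.1 i.2.2.2.2) -
      infoX₂YgivenV W (p i.2.1) (q i.2.1) i.1|).bddAbove
  obtain ⟨B₂, h₂⟩ := (Set.finite_range fun i : Delay dMin dMax × L × Window X₁ dMin dMax ×
    (X₂ × Y) => |sumDensity W (p i.2.1) (q i.2.1) i.1 i.2.2.1 i.2.2.2 -
      (infoX₁Y W (p i.2.1) (q i.2.1) i.1 + infoX₂YgivenV W (p i.2.1) (q i.2.1) i.1)|).bddAbove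
  exact ⟨max B₁ B₂, fun d l v z => (h₁ ⟨(d, l, v, z), rfl⟩).trans (le_max_left _ _),
    fun d l v z => (h₂ ⟨(d, l, v, z), rfl⟩).trans (le_max_right _ _)⟩

/-- Time sharing between several input laws, with the rates reduced by `δ`. -/
theorem achievable_of_add_le {w : L → ℝ} (hw : ∀ l, 0 ≤ w l) (hw1 : ∑ l, w l = 1)
    {z : L → ℝ × ℝ} (hz₁ : ∀ l, 0 ≤ (z l).1) (hz₂ : ∀ l, 0 ≤ (z l).2)
    (hsum : ∀ l d, (z l).1 + (z l).2 ≤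
      infoX₁Y W (p l) (q l) d + infoX₂YgivenV W (p l) (q l) d)
    (hsnd : ∀ l d, (z l).2 ≤ infoX₂YgivenV W (p l) (q l) d)
    {R : ℝ × ℝ} (hR₁ : 0 ≤ R.1) (hR₂ : 0 ≤ R.2) {δ : ℝ} (hδ : 0 < δ)
    (h₁ : R.1 ≠ 0 → R.1 + R.2 + 2 * δ ≤ ∑ l, w l * ((z l).1 + (z l).2))
    (h₂ : R.2 ≠ 0 → R.2 + 2 * δ ≤ ∑ l, w l * (z l).2) :
    Achievable W dMin dMax R := by
  classical
  have hL : Nonempty L := by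
    by_contra h
    rw [not_nonempty_iff] at h
    simp at hw1
  obtain ⟨l₀⟩ := hL
  have hX₁ : Nonempty X₁ := by
    by_contra h
    rw [not_nonempty_iff] at h
    simpa using (p l₀).2.2
  have hX₂ : Nonempty X₂ := by
    by_contra h
    rw [not_nonempty_iff] at h
    simpa using (q l₀ fun _ => Classical.arbitrary X₁).2.2
  obtain ⟨B, hB₂, hB⟩ := exists_density_bound W p q
  set N : ℝ := (Fintype.card (Delay dMin dMax) : ℝ)
  set C : ℕ := 2 * (dMin + dMax) + 1
  set c₀ : ℝ := (dMin + dMax + 1) * ∑ l, ((z l).1 + (z l).2)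
  -- The 4 comes from Chebyshev with deviation `s = n * δ / 2`; the 3 is 1 for competitors with the
  -- same first message plus 2 for the others.
  set b : ℕ → ℝ := fun n => N * (2 * (4 * (C * B ^ 2) / δ ^ 2 * (n : ℝ)⁻¹) +
    N * (3 * ((2 : ℝ) ^ (-δ)) ^ n)) with hb
  have hb0 : Tendsto b atTop (𝓝 0) := by
    have hpow : Tendsto (fun n : ℕ => ((2 : ℝ) ^ (-δ)) ^ n) atTop (𝓝 0) :=
      tendsto_pow_atTop_nhds_zero_of_lt_one (Real.rpow_nonneg two_pos.le _)
        (Real.rpow_lt_one_of_one_lt_of_neg one_lt_two (neg_lt_zero.2 hδ))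
    have := ((((tendsto_inv_atTop_nhds_zero_nat (𝕜 := ℝ)).const_mul
      (4 * (C * B ^ 2) / δ ^ 2)).const_mul 2).add ((hpow.const_mul 3).const_mul N)).const_mul N
    simpa [hb] using this
  -- The loss at segment ends is at most `c₀`. Once it is below `n * δ / 2`, thresholds `n * δ`
  -- under the target still leave a deviation of `n * δ / 2`.
  refine ⟨hR₁, hR₂, fun n => if 0 < n ∧ 2 * c₀ ≤ n * δ then b n else 1, ?_, fun n => ?_⟩
  · refine hb0.congr' ?_
    filter_upwards [eventually_gt_atTop 0, eventually_ge_atTop ⌈2 * c₀ / δ⌉₊] with n hn hn'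
    have : 2 * c₀ ≤ n * δ := (div_le_iff₀ hδ).1 (Nat.ceil_le.1 hn')
    exact (if_pos ⟨hn, this⟩).symm
  beta_reduce
  split_ifs with hn
  swap
  · exact ⟨⟨fun _ _ => Classical.arbitrary _, fun _ _ _ => Classical.arbitrary _,
      fun _ => (⟨0, ceil_rpow_pos _⟩, ⟨0, ceil_rpow_pos _⟩)⟩,
      fun d w => avgError_le_one W _ _ _⟩
  obtain ⟨hn0, hnc⟩ := hn
  have hn0' : (0 : ℝ) < n := Nat.cast_pos.2 hn0
  obtain ⟨blk, start, len, hlen, hblk⟩ := exists_blocks hw hw1 n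
  have hle : (dMin + dMax + 1) * ∑ l, (z l).2 ≤ c₀ := by
    refine mul_le_mul_of_nonneg_left (Finset.sum_le_sum fun l _ => ?_) (by positivity)
    linarith [hz₁ l]
  have hm₂ : ∀ d, n * (∑ l, w l * (z l).2 - δ) + n * δ / 2 ≤
      ∑ k : Interior dMin dMax blk, infoX₂YgivenV W (p (blk k.1)) (q (blk k.1)) d := fun d => by
    have := le_sum_interior (dMin := dMin) (dMax := dMax) hblk hlen hz₂ fun l => hsnd l d
    linarith
  have hm : ∀ d, n * (∑ l, w l * ((z l).1 + (z l).2) - δ) + n * δ / 2 ≤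
      ∑ k : Interior dMin dMax blk, (infoX₁Y W (p (blk k.1)) (q (blk k.1)) d +
        infoX₂YgivenV W (p (blk k.1)) (q (blk k.1)) d) := fun d => by
    have := le_sum_interior (dMin := dMin) (dMax := dMax) hblk hlen
      (fun l => add_nonneg (hz₁ l) (hz₂ l)) fun l => hsum l d
    linarith
  obtain ⟨x₁, x₂, dec, hcode⟩ := exists_window_code W p q windowPos
    (fun k : Interior dMin dMax blk => blk k.1) blk blk_windowPos windowPos_injective
    windowPos_injective_left ncard_overlap_le hB₂ hB (s := n * δ / 2) (by positivity) hm₂ hm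
    (ceil_rpow_pos (n * R.1)) (ceil_rpow_pos (n * R.2))
  refine ⟨interiorCode (Classical.arbitrary X₂) x₁ x₂ dec, fun d w => ?_⟩
  rw [avgError_interiorCode]
  refine (hcode d).trans ?_
  have hN : 0 ≤ N := Nat.cast_nonneg _
  refine mul_le_mul_of_nonneg_left (add_le_add (mul_le_mul_of_nonneg_left ?_ two_pos.le)
    (mul_le_mul_of_nonneg_left ?_ hN)) hN
  · have hcard : (Fintype.card (Interior dMin dMax blk) : ℝ) ≤ n := by
      have := Fintype.card_subtype_le fun i : Fin n => dMax ≤ (i : ℕ) ∧ (i : ℕ) + dMin < n ∧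
        ∀ j : Fin n, (i : ℕ) ≤ j + dMax → (j : ℕ) ≤ i + dMin → blk j = blk i
      rw [Fintype.card_fin] at this
      exact_mod_cast this
    calc _ ≤ n * (C * B ^ 2) / (n * δ / 2) ^ 2 := by gcongr
      _ = _ := by
        field_simp
        norm_num
  · have e₂ := ceil_rpow_sub_one_mul_le n h₂
    have e₁ := ceil_rpow_sub_one_mul_mul_le hR₂ n h₁
    linarith

theorem tendsto_one_sub_smul (R : ℝ × ℝ) :
    Tendsto (fun n : ℕ => (1 - 1 / ((n : ℝ) + 1)) • R) atTop (𝓝 R) := by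
  have h := (tendsto_one_div_add_atTop_nhds_zero_nat (𝕜 := ℝ)).const_sub 1
  simpa using h.smul_const R

theorem convexHull_innerRegion_subset (dMin dMax : ℕ) :
    convexHull ℝ (innerRegion W dMin dMax) ⊆ capacityRegion W dMin dMax := by
  intro R hR
  obtain ⟨L, _, w, z, hw, hw1, hz, hwz⟩ := mem_convexHull_iff_exists_fintype.1 hR
  simp only [innerRegion, Set.mem_iUnion, Set.mem_ofPred_eq] at hz
  choose p q hz₁ hz₂ hsum hsnd using hz
  have hR₁ : R.1 = ∑ l, w l * (z l).1 := by
    rw [← hwz, Prod.fst_sum]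
    rfl
  have hR₂ : R.2 = ∑ l, w l * (z l).2 := by
    rw [← hwz, Prod.snd_sum]
    rfl
  have hR₁0 : 0 ≤ R.1 := hR₁ ▸ Finset.sum_nonneg fun l _ => mul_nonneg (hw l) (hz₁ l)
  have hR₂0 : 0 ≤ R.2 := hR₂ ▸ Finset.sum_nonneg fun l _ => mul_nonneg (hw l) (hz₂ l)
  refine mem_closure_of_tendsto (tendsto_one_sub_smul R) (Eventually.of_forall fun n => ?_)
  set η : ℝ := 1 / ((n : ℝ) + 1)
  have hη : 0 < η := by positivity
  have hη1 : η ≤ 1 := by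
    rw [div_le_one (by positivity)]
    linarith [n.cast_nonneg (α := ℝ)]
  -- Scaling by `1 - η` frees `η * R.1` and `η * R.2`. A zero coordinate frees nothing, but needs no
  -- slack.
  obtain ⟨δ, hδ, hδ₁, hδ₂⟩ : ∃ δ : ℝ, 0 < δ ∧ (R.1 ≠ 0 → 2 * δ ≤ η * R.1) ∧
      (R.2 ≠ 0 → 2 * δ ≤ η * R.2) := by
    have h : ∀ x : ℝ, 0 ≤ x → ∃ δ : ℝ, 0 < δ ∧ (x ≠ 0 → 2 * δ ≤ η * x) := fun x hx => by
      rcases eq_or_ne x 0 with h | h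
      · exact ⟨1, one_pos, fun h' => absurd h h'⟩
      · have : 0 < x := lt_of_le_of_ne hx h.symm
        exact ⟨η * x / 2, by positivity, fun _ => by linarith⟩
    obtain ⟨δ₁, h₁, h₁'⟩ := h _ hR₁0
    obtain ⟨δ₂, h₂, h₂'⟩ := h _ hR₂0
    exact ⟨min δ₁ δ₂, lt_min h₁ h₂,
      fun h0 => le_trans (by linarith [min_le_left δ₁ δ₂]) (h₁' h0),
      fun h0 => le_trans (by linarith [min_le_right δ₁ δ₂]) (h₂' h0)⟩
  have hbdd : ∀ f : Delay dMin dMax → ℝ, BddBelow (Set.range f) :=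
    fun f => (Set.finite_range f).bddBelow
  refine achievable_of_add_le W p q hw hw1 hz₁ hz₂
    (fun l d => (hsum l).trans (ciInf_le (hbdd _) d))
    (fun l d => (hsnd l).trans (ciInf_le (hbdd _) d)) (δ := δ)
    (mul_nonneg (by linarith) hR₁0) (mul_nonneg (by linarith) hR₂0) hδ ?_ ?_
  · simp only [mul_add, Finset.sum_add_distrib, ← hR₁, ← hR₂, Prod.smul_fst, Prod.smul_snd,
      smul_eq_mul]
    intro h
    have := hδ₁ fun h0 => h (by rw [h0, mul_zero])
    nlinarith
  · simp only [← hR₂, Prod.smul_snd, smul_eq_mul]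
    intro h
    have := hδ₂ fun h0 => h (by rw [h0, mul_zero])
    nlinarith

end Achievability

end ACMAC

end

theorem mainTheorem2 {X₁ X₂ Y : Type*} [Fintype X₁] [Fintype X₂] [Fintype Y]
    (W : X₁ → X₂ → stdSimplex ℝ Y) (dMin dMax : ℕ) :
    closure (convexHull ℝ (ACMAC.innerRegion W dMin dMax)) ⊆
      ACMAC.capacityRegion W dMin dMax :=
  closure_minimal (ACMAC.convexHull_innerRegion_subset W dMin dMax) isClosed_closure
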